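/- Let $\mathbb K$ be a field of characteristic $0$, $I$ a finite set, and $P$ a set partitioned into $\{P_i\}_{i\in I}$. Each $p\in P$ has a weight $w_p\in\mathbb Z_{\ge1}$, with only finitely many $p$ of each weight, and a finite set $E_p$ of insertion places. Let $\mathcal E=\{E_p\}_{p\in P}$ and $\mathbf s=(s_i)\in\mathbb K^I$, and suppose that the insertion exponents $\mu_e\in\mathbb K^I$ have the form $$\mu_e=u_e\mathbf 1_i+\alpha_e\mathbf s\qquad(e\in E_p,\ p\in P_i),$$ where $\mathbf 1_i$ is the $i$-th unit vector, $u_e\in\mathbb K$, $\alpha_e\in\mathbb Z_{\ge0}$, $\sum_{e\in E_p}u_e=1$ and $\sum_{e\in E_p}\alpha_e=w_p$ for all $p\in P$. For a vector $\mathbf F=(F_i)_{i\in I}$ of power series in $x$ with constant term $1$ and $\mu\in\mathbb K^I$ write $\mathbf F^\mu=\prod_iF_i^{\mu_i}$, powers being given by the binomial series. Linear operators act coefficientwise on power series in $x$. Let $\widetilde{\mathcal H}=\widetilde{\mathcal H}_{P,\mathcal E}$ be the commutative algebra freely generated by the isomorphism classes of rooted trees in which each vertex is decorated by an element of $P$ and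 each edge from a parent of type $p$ to a child is decorated by an element of $E_p$. It is a bialgebra with $\Delta(F)=\sum_DD\otimes(F\setminus D)$ for a forest $F$, where $D$ runs over the downsets of $F$ (the root of a tree being its largest element), and with counit vanishing on nonempty forests. Let $\tilde B_+^{(p)}\colon\widetilde{\mathcal H}^{\otimes E_p}\to\widetilde{\mathcal H}$ be the linear map sending $\bigotimes_ef_e$, for forests $f_e$, to the tree obtained by adding a root decorated by $p$ and joining it to each component of $f_e$ by an edge decorated by $e$. Let $\mathsf{Rio}=\mathbb K[\pi_1,\pi_2,\dots,y_1,y_2,\dots]$, $\pi_0=y_0=1$, $\Pi(x)=\sum_{n\ge0}\pi_nx^{n+1}$, $Y(x)=\sum_{n\ge0}y_nx^n$, be the bialgebra with $$\Delta\pi_n=\sum_{k=0}^n[x^{n+1}]\Pi(x)^{k+1}\otimes\pi_k,\qquad \Delta y_n=\sum_{j=0}^n[x^n]Y(x)\Pi(x)^j\otimes y_j,$$ and counit $\pi_n,y_n\mapsto0$ for $n\ge1$. (1) The combinatorial Dyson–Schwinger system $$T_i(x)=1+\sum_{p\in P_i}\tilde B_+^{(p)}\Big(\bigotimes_{e\in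 E_p}T_i(x)^{u_e}Q(x)^{\alpha_e}\Big),\qquad Q(x)=x\prod_{j\in I}T_j(x)^{s_j}\qquad(i\in I),$$ has a unique solution $\mathbf T(x)\in\widetilde{\mathcal H}[[x]]^I$. It also satisfies $T_i(x)=1+\sum_{p\in P_i}x^{w_p}\tilde B_+^{(p)}\big(\bigotimes_{e\in E_p}\mathbf T(x)^{\mu_e}\big)$ for all $i$. For every $i\in I$, the algebra morphism $\phi_i\colon\mathsf{Rio}\to\widetilde{\mathcal H}$ with $\phi_i(Y(x))=T_i(x)$ and $\phi_i(\Pi(x))=Q(x)$ is a bialgebra morphism. (2) Consider $\mathbb K[L]$ as a bialgebra with $\Delta L=L\otimes1+1\otimes L$, $\varepsilon(L)=0$, and for each $p\in P$ consider $\mathbb K[L_e:e\in E_p]$ as a left $\mathbb K[L]$-comodule whose coaction $\delta$ is the algebra morphism with $\delta L_e=L\otimes1+1\otimes L_e$. For each $p\in P$ let $\Lambda_p\colon\mathbb K[L_e:e\in E_p]\to\mathbb K[L]$ be a 1-cocycle, i.e. a linear map with $\Delta\Lambda_p=\Lambda_p\otimes1+(\mathrm{id}\otimes\Lambda_p)\delta$.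 Then the Dyson–Schwinger system $$G_i(x,L)=1+\sum_{p\in P_i}x^{w_p}\Lambda_p\Big(\prod_{e\in E_p}\mathbf G(x,L_e)^{\mu_e}\Big)\qquad(i\in I)$$ has a unique solution $\mathbf G\in\mathbb K[L][[x]]^I$, and for every $i\in I$ it satisfies the renormalization group equation $$\Big(\frac{\partial}{\partial L}-\beta(x)\frac{\partial}{\partial x}-\gamma_i(x)\Big)G_i(x,L)=0,\qquad\beta(x)=x\sum_{j\in I}s_j\gamma_j(x),$$ where $\gamma_j(x)$ is the coefficient of $L$ in $G_j(x,L)$. -/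

import Mathlib

open scoped TensorProduct
namespace DysonSchwinger
section Poly
variable (K : Type*) [Field K]

/-- The bialgebra `K[L]`, with `Δ L = 1 ⊗ L + L ⊗ 1` and `ε L = 0`. -/
noncomputable instance polyBialgebra : Bialgebra K (Polynomial K) :=
  Bialgebra.ofAlgHom
    (Polynomial.aeval (1 ⊗ₜ[K] Polynomial.X + Polynomial.X ⊗ₜ[K] 1))
    (Polynomial.aeval 0)
    (by ext; simp [TensorProduct.tmul_add, TensorProduct.add_tmul, Algebra.TensorProduct.one_def]; abel)
    (by ext; simp)
    (by ext; simp)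

end Poly

section Rio
variable (K : Type*) [Field K]

/-- The Riordan Hopf algebra: as an algebra, the polynomial algebra over `K` in the variables
`π₁, π₂, …` (indexed by `Sum.inl 0, Sum.inl 1, …`) and `y₁, y₂, …` (indexed by `Sum.inr`). -/
def Rio : Type _ := MvPolynomial (ℕ ⊕ ℕ) K

noncomputable instance : CommRing (Rio K) := inferInstanceAs (CommRing (MvPolynomial (ℕ ⊕ ℕ) K))
noncomputable instance : Algebra K (Rio K) := inferInstanceAs (Algebra K (MvPolynomial (ℕ ⊕ ℕ) K))

namespace Rio

open Algebra.TensorProduct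

/-- The generators `π n`, with the convention `π 0 = 1`. -/
noncomputable def π : ℕ → Rio K
  | 0 => 1
  | n + 1 => (MvPolynomial.X (Sum.inl n) : MvPolynomial (ℕ ⊕ ℕ) K)

/-- The generators `y n`, with the convention `y 0 = 1`. -/
noncomputable def y : ℕ → Rio K
  | 0 => 1
  | n + 1 => (MvPolynomial.X (Sum.inr n) : MvPolynomial (ℕ ⊕ ℕ) K)

/-- `Π(x) = x + ∑ n ≥ 1, π n x ^ (n + 1)`. -/
noncomputable def Pi : PowerSeries (Rio K) := PowerSeries.X * PowerSeries.mk (π K)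

/-- `Y(x) = 1 + ∑ n ≥ 1, y n x ^ n`. -/
noncomputable def Y : PowerSeries (Rio K) := PowerSeries.mk (y K)

/-- The algebra morphism with `π n ↦ a n` and `y n ↦ b n` for `n ≥ 1`. -/
noncomputable def lift {A : Type*} [CommRing A] [Algebra K A] (a b : ℕ → A) : Rio K →ₐ[K] A :=
  (MvPolynomial.aeval (Sum.elim (fun n => a (n + 1)) (fun n => b (n + 1))) :
    MvPolynomial (ℕ ⊕ ℕ) K →ₐ[K] A)

/-- The coproduct `Δ π n = ∑ k ≤ n, [x ^ (n + 1)] Π(x) ^ (k + 1) ⊗ π k` and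
`Δ y n = ∑ j ≤ n, [x ^ n] Y(x) Π(x) ^ j ⊗ y j`. -/
noncomputable def comulHom : Rio K →ₐ[K] Rio K ⊗[K] Rio K :=
  lift K
    (fun n => ∑ k ∈ Finset.range (n + 1), PowerSeries.coeff (n + 1) (Pi K ^ (k + 1)) ⊗ₜ[K] π K k)
    (fun n => ∑ j ∈ Finset.range (n + 1), PowerSeries.coeff n (Y K * Pi K ^ j) ⊗ₜ[K] y K j)

/-- The counit, sending all `π n` and `y n` with `n ≥ 1` to `0`. -/
noncomputable def counitHom : Rio K →ₐ[K] K := lift K (fun _ => 0) (fun _ => 0)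

variable {K}

lemma lift_π {A : Type*} [CommRing A] [Algebra K A] (a b : ℕ → A) (n : ℕ) :
    lift K a b (π K (n + 1)) = a (n + 1) :=
  MvPolynomial.aeval_X (R := K) _ (Sum.inl n)

lemma lift_y {A : Type*} [CommRing A] [Algebra K A] (a b : ℕ → A) (n : ℕ) :
    lift K a b (y K (n + 1)) = b (n + 1) :=
  MvPolynomial.aeval_X (R := K) _ (Sum.inr n)

lemma hasSubst_Pi {A : Type*} [CommRing A] (f : Rio K →+* A) :
    PowerSeries.HasSubst (PowerSeries.map f (Pi K)) :=
  PowerSeries.HasSubst.of_constantCoeff_zero' (by simp [Pi])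

lemma hom_ext {A : Type*} [CommRing A] [Algebra K A] {f g : Rio K →ₐ[K] A}
    (h₁ : PowerSeries.map f.toRingHom (Pi K) = PowerSeries.map g.toRingHom (Pi K))
    (h₂ : PowerSeries.map f.toRingHom (Y K) = PowerSeries.map g.toRingHom (Y K)) : f = g := by
  refine MvPolynomial.algHom_ext (R := K) (σ := ℕ ⊕ ℕ) (f := f) (g := g) ?_
  rintro (n | n)
  · have h := congrArg (PowerSeries.coeff (n + 2)) h₁
    simp only [Pi, PowerSeries.coeff_map, PowerSeries.coeff_succ_X_mul, PowerSeries.coeff_mk] at h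
    exact h
  · have h := congrArg (PowerSeries.coeff (n + 1)) h₂
    simp only [Y, PowerSeries.coeff_map, PowerSeries.coeff_mk] at h
    exact h

lemma coeff_subst_Pi {A : Type*} [CommRing A] (f : Rio K →+* A) (g : PowerSeries A) (n : ℕ) :
    PowerSeries.coeff n (g.subst (PowerSeries.map f (Pi K))) =
      ∑ d ∈ Finset.range (n + 1), PowerSeries.coeff d g * f (PowerSeries.coeff n (Pi K ^ d)) := by
  rw [PowerSeries.coeff_subst' (hasSubst_Pi f), finsum_eq_sum_of_support_subset (s := Finset.range (n + 1))]
  · simp [← map_pow]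
  · intro d hd
    by_contra hn
    apply hd
    have : n < d := by simpa using hn
    show _ • _ = _
    rw [← map_pow, PowerSeries.coeff_map, Pi, mul_pow, PowerSeries.coeff_X_pow_mul']
    simp [this.not_ge]

lemma map_comul_Pi : PowerSeries.map (comulHom K).toRingHom (Pi K) =
    (PowerSeries.map (includeRight : Rio K →ₐ[K] Rio K ⊗[K] Rio K).toRingHom (Pi K)).subst
      (PowerSeries.map (includeLeft : Rio K →ₐ[K] Rio K ⊗[K] Rio K).toRingHom (Pi K)) := by
  ext n
  rw [coeff_subst_Pi]
  rcases n with _ | _ | n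
  · simp [Pi]
  · simp [Pi, Finset.sum_range_succ, π, PowerSeries.coeff_succ_X_mul, one_def]
  · rw [Finset.sum_range_succ']
    simp [Pi, PowerSeries.coeff_succ_X_mul, comulHom, lift_π]

lemma map_comul_Y : PowerSeries.map (comulHom K).toRingHom (Y K) =
    PowerSeries.map (includeLeft : Rio K →ₐ[K] Rio K ⊗[K] Rio K).toRingHom (Y K) *
    (PowerSeries.map (includeRight : Rio K →ₐ[K] Rio K ⊗[K] Rio K).toRingHom (Y K)).subst
      (PowerSeries.map (includeLeft : Rio K →ₐ[K] Rio K ⊗[K] Rio K).toRingHom (Pi K)) := by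
  ext n
  simp only [PowerSeries.coeff_mul, coeff_subst_Pi]
  have hL : PowerSeries.coeff n (PowerSeries.map (comulHom K).toRingHom (Y K)) =
      ∑ j ∈ Finset.range (n + 1), PowerSeries.coeff n (Y K * Pi K ^ j) ⊗ₜ[K] y K j := by
    rcases n with _ | n
    · simp [Y, y, one_def]
    · simp [Y, comulHom, lift_y]
  rw [hL]
  have key : ∀ p ∈ Finset.HasAntidiagonal.antidiagonal n, ∀ g : PowerSeries (Rio K ⊗[K] Rio K),
      ∑ d ∈ Finset.range (p.2 + 1), PowerSeries.coeff d g *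
        (includeLeft : Rio K →ₐ[K] Rio K ⊗[K] Rio K).toRingHom (PowerSeries.coeff p.2 (Pi K ^ d)) =
      ∑ d ∈ Finset.range (n + 1), PowerSeries.coeff d g *
        (includeLeft : Rio K →ₐ[K] Rio K ⊗[K] Rio K).toRingHom
          (PowerSeries.coeff p.2 (Pi K ^ d)) := by
    intro p hp g
    have := Finset.HasAntidiagonal.mem_antidiagonal.1 hp
    refine Finset.sum_subset (Finset.range_mono (by omega)) fun d _ hd => ?_
    have : p.2 < d := by simpa using hd
    rw [Pi, mul_pow, PowerSeries.coeff_X_pow_mul']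
    simp [this.not_ge]
  refine Eq.trans ?_ (Finset.sum_congr rfl fun p hp => congrArg (_ * ·) (key p hp _).symm)
  simp only [Finset.mul_sum]
  rw [Finset.sum_comm]
  refine Finset.sum_congr rfl fun j _ => ?_
  rw [PowerSeries.coeff_mul, TensorProduct.sum_tmul]
  refine Finset.sum_congr rfl fun p _ => ?_
  simp [Y]

lemma map_map_series {A B C : Type*} [CommRing A] [CommRing B] [CommRing C] (g : B →+* C)
    (f : A →+* B) (F : PowerSeries A) :
    PowerSeries.map g (PowerSeries.map f F) = PowerSeries.map (g.comp f) F := by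
  ext n; simp

lemma map_hom_comul_Pi {A : Type*} [CommRing A] [Algebra K A] (f : Rio K ⊗[K] Rio K →ₐ[K] A) :
    PowerSeries.map (f.comp (comulHom K)).toRingHom (Pi K) =
      (PowerSeries.map (f.comp Algebra.TensorProduct.includeRight).toRingHom (Pi K)).subst
        (PowerSeries.map (f.comp Algebra.TensorProduct.includeLeft).toRingHom (Pi K)) := by
  have h := congrArg (PowerSeries.map f.toRingHom) (map_comul_Pi (K := K))
  rw [map_map_series] at h
  refine h.trans ?_
  refine (PowerSeries.map_subst (h := f.toRingHom) (hasSubst_Pi _) _).trans ?_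
  exact congrArg₂ _ (map_map_series _ _ _) (map_map_series _ _ _)

lemma map_hom_comul_Y {A : Type*} [CommRing A] [Algebra K A] (f : Rio K ⊗[K] Rio K →ₐ[K] A) :
    PowerSeries.map (f.comp (comulHom K)).toRingHom (Y K) =
      PowerSeries.map (f.comp Algebra.TensorProduct.includeLeft).toRingHom (Y K) *
      (PowerSeries.map (f.comp Algebra.TensorProduct.includeRight).toRingHom (Y K)).subst
        (PowerSeries.map (f.comp Algebra.TensorProduct.includeLeft).toRingHom (Pi K)) := by
  have h := congrArg (PowerSeries.map f.toRingHom) (map_comul_Y (K := K))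
  rw [map_map_series, map_mul, map_map_series] at h
  refine h.trans ?_
  congr 1
  refine (PowerSeries.map_subst (h := f.toRingHom) (hasSubst_Pi _) _).trans ?_
  exact congrArg₂ _ (map_map_series _ _ _) (map_map_series _ _ _)

lemma map_counit_Pi {A : Type*} [CommRing A] [Algebra K A] (f : K →ₐ[K] A) :
    PowerSeries.map (f.comp (counitHom K)).toRingHom (Pi K) = PowerSeries.X := by
  ext n
  rcases n with _ | _ | n
  · simp [Pi]
  · simp [Pi, PowerSeries.coeff_succ_X_mul, π]
  · simp [Pi, PowerSeries.coeff_succ_X_mul, counitHom, lift_π, PowerSeries.coeff_X]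

lemma map_counit_Y {A : Type*} [CommRing A] [Algebra K A] (f : K →ₐ[K] A) :
    PowerSeries.map (f.comp (counitHom K)).toRingHom (Y K) = 1 := by
  ext n
  rcases n with _ | n
  · simp [Y, y]
  · simp [Y, counitHom, lift_y, PowerSeries.coeff_one]

noncomputable instance : Bialgebra K (Rio K) :=
  Bialgebra.ofAlgHom (comulHom K) (counitHom K)
    (by
      have hL : ((Algebra.TensorProduct.assoc K K K (Rio K) (Rio K) (Rio K)).toAlgHom.comp
          (map (comulHom K) (.id K (Rio K)))).comp includeLeft =
          ((Algebra.TensorProduct.assoc K K K (Rio K) (Rio K) (Rio K)).toAlgHom.comp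
            includeLeft).comp (comulHom K) := by ext x; simp
      have hR : (map (.id K (Rio K)) (comulHom K)).comp includeRight =
          (includeRight : _ →ₐ[K] Rio K ⊗[K] (Rio K ⊗[K] Rio K)).comp (comulHom K) := by
        ext x; simp
      have e1 : ((Algebra.TensorProduct.assoc K K K (Rio K) (Rio K) (Rio K)).toAlgHom.comp
            includeLeft).comp includeLeft =
          (map (.id K (Rio K)) (comulHom K)).comp includeLeft := by
        ext x; simp [one_def]
      have e2 : ((Algebra.TensorProduct.assoc K K K (Rio K) (Rio K) (Rio K)).toAlgHom.comp
            includeLeft).comp includeRight =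
          (includeRight : _ →ₐ[K] Rio K ⊗[K] (Rio K ⊗[K] Rio K)).comp includeLeft := by
        ext x; simp
      have e3 : ((Algebra.TensorProduct.assoc K K K (Rio K) (Rio K) (Rio K)).toAlgHom.comp
          (map (comulHom K) (.id K (Rio K)))).comp includeRight =
          (includeRight : _ →ₐ[K] Rio K ⊗[K] (Rio K ⊗[K] Rio K)).comp includeRight := by
        ext x; simp [one_def]
      rw [← AlgHom.comp_assoc]
      refine hom_ext ?_ ?_
      · rw [map_hom_comul_Pi, map_hom_comul_Pi, hL, hR, map_hom_comul_Pi, map_hom_comul_Pi,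
          e1, e2, e3, PowerSeries.subst_comp_subst_apply (hasSubst_Pi _) (hasSubst_Pi _)]
      · rw [map_hom_comul_Y, map_hom_comul_Y, hL, hR, map_hom_comul_Y, map_hom_comul_Y,
          map_hom_comul_Pi, e1, e2, e3, PowerSeries.subst_mul (hasSubst_Pi _),
          PowerSeries.subst_comp_subst_apply (hasSubst_Pi _) (hasSubst_Pi _), mul_assoc])
    (by
      have e1 : (map (counitHom K) (.id K (Rio K))).comp includeLeft =
          includeLeft.comp (counitHom K) := by ext x; simp
      have e2 : (map (counitHom K) (.id K (Rio K))).comp includeRight = includeRight := by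
        ext x; simp
      refine hom_ext ?_ ?_
      · rw [map_hom_comul_Pi, e1, e2, map_counit_Pi, PowerSeries.X_subst]; rfl
      · rw [map_hom_comul_Y, e1, e2, map_counit_Pi, map_counit_Y, PowerSeries.X_subst, one_mul]
        rfl)
    (by
      have e1 : (map (.id K (Rio K)) (counitHom K)).comp includeRight =
          includeRight.comp (counitHom K) := by ext x; simp
      have e2 : (map (.id K (Rio K)) (counitHom K)).comp includeLeft = includeLeft := by
        ext x; simp
      refine hom_ext ?_ ?_
      · rw [map_hom_comul_Pi, e1, e2, map_counit_Pi, PowerSeries.subst_X (hasSubst_Pi _)]; rfl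
      · rw [map_hom_comul_Y, e1, e2, map_counit_Y, ← PowerSeries.coe_substAlgHom (hasSubst_Pi _),
          map_one, mul_one]
        rfl)

end Rio
end Rio
section Trees

/-- Representatives of rooted trees with vertices decorated by `p : P` and each edge from a parent
of type `p` to a child decorated by an element of `E p`: the tree `node p n e c` has root decorated
by `p`, and `n` children; the `j`-th child carries the subtree `c j`, on an edge decorated by
`e j`. -/
inductive PTree (P : Type*) (E : P → Type*) : Type _
  | node (p : P) (n : ℕ) (e : Fin n → E p) (c : Fin n → PTree P E) : PTree P E

namespace PTree
variable {P : Type*} {E : P → Type*}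

/-- Isomorphism of decorated rooted trees: the children are matched by a bijection which preserves
edge decorations, and matched subtrees are isomorphic. -/
inductive Iso : PTree P E → PTree P E → Prop
  | node (p : P) (n m : ℕ) (e : Fin n → E p) (c : Fin n → PTree P E)
      (e' : Fin m → E p) (c' : Fin m → PTree P E) (σ : Fin n ≃ Fin m)
      (he : ∀ j, e j = e' (σ j)) (hc : ∀ j, Iso (c j) (c' (σ j))) :
      Iso (PTree.node p n e c) (PTree.node p m e' c')

lemma Iso.refl : ∀ t : PTree P E, Iso t t
  | .node p n e c => .node p n n e c e c (Equiv.refl _) (fun _ => rfl) fun j => Iso.refl (c j)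

lemma Iso.symm {t t' : PTree P E} (h : Iso t t') : Iso t' t := by
  induction h with
  | node p n m e c e' c' σ he hc ih =>
    refine .node p m n e' c' e c σ.symm (fun j => ?_) fun j => ?_
    · simpa using (he (σ.symm j)).symm
    · simpa using ih (σ.symm j)

lemma Iso.trans {t t' t'' : PTree P E} (h : Iso t t') (h' : Iso t' t'') : Iso t t'' := by
  induction h generalizing t'' with
  | node p n m e c e' c' σ he hc ih =>
    cases h' with
    | node _ _ k _ _ e'' c'' τ he' hc' =>
      exact .node p n k e c e'' c'' (σ.trans τ) (fun j => (he j).trans (he' (σ j)))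
        fun j => ih j (hc' (σ j))

instance setoid (P : Type*) (E : P → Type*) : Setoid (PTree P E) :=
  ⟨Iso, Iso.refl, Iso.symm, Iso.trans⟩

/-- The downsets of the tree `t` that do not contain its root (vertices are ordered so that the
root is the largest): for each child, either the whole subtree at that child belongs to the downset
(`none`), or the downset meets that subtree in a downset not containing the child (`some`). -/
def Cut : PTree P E → Type
  | .node _ n _ c => (j : Fin n) → Option (Cut (c j))

instance instFintypeCut : (t : PTree P E) → Fintype (Cut t)
  | .node _ _ _ c =>
    letI := fun j => instFintypeCut (c j)
    inferInstanceAs (Fintype (∀ j, Option (Cut (c j))))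

end PTree

/-- Rooted trees with decorated vertices and edges, up to isomorphism. -/
def DTree (P : Type*) (E : P → Type*) : Type _ := Quotient (PTree.setoid P E)

namespace DTree
variable {P : Type*} {E : P → Type*}

/-- The isomorphism class of a tree. -/
def mk (t : PTree P E) : DTree P E := Quotient.mk _ t

/-- The tree with root decorated by `p` and children given by the multiset `m` of pairs (decoration
of the edge to the child, subtree at the child).  See `mk_node`. -/
noncomputable def node (p : P) (m : Multiset (E p × DTree P E)) : DTree P E :=
  mk (.node p m.toList.length (fun j => (m.toList.get j).1) fun j => (m.toList.get j).2.out)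

lemma mk_out (t : DTree P E) : mk t.out = t := Quotient.out_eq t

lemma mk_node (p : P) (n : ℕ) (e : Fin n → E p) (c : Fin n → PTree P E) :
    mk (.node p n e c) = node p (Finset.univ.val.map fun j => (e j, mk (c j))) := by
  classical
  set m : Multiset (E p × DTree P E) := Finset.univ.val.map fun j => (e j, mk (c j)) with hm
  have hperm : (List.ofFn fun j => (e j, mk (c j))).Perm m.toList := by
    rw [← Multiset.coe_eq_coe, Multiset.coe_toList, hm]
    simp [List.ofFn_eq_map, Finset.univ, Fintype.elems]
  let σ : Fin n ≃ Fin m.toList.length :=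
    (finCongr (by simp)).trans (Equiv.ofBijective hperm.idxBij
      ⟨hperm.idxBij_injective, hperm.idxBij_surjective⟩)
  have hσ : ∀ j, m.toList.get (σ j) = (e j, mk (c j)) := by
    intro j
    have := hperm.getElem_idxBij_eq_getElem (finCongr (by simp) j)
    exact this.trans (by simp)
  refine Quotient.sound (PTree.Iso.node p _ _ _ _ _ _ σ (fun j => ?_) fun j => ?_)
  · rw [hσ]
  · refine Quotient.exact (s := PTree.setoid P E) ?_
    rw [hσ]
    exact (Quotient.out_eq _).symm

end DTree

namespace PTree
variable {P : Type*} {E : P → Type*}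

/-- The forest (multiset of trees) formed by the vertices of a downset not containing the root. -/
noncomputable def lower : (t : PTree P E) → Cut t → Multiset (DTree P E)
  | .node _ _ _ c, d => ∑ j, match d j with
      | none => {DTree.mk (c j)}
      | some d' => lower (c j) d'

/-- The tree formed by the complement of a downset not containing the root; remaining vertices and
edges keep their decorations. -/
noncomputable def upper : (t : PTree P E) → Cut t → DTree P E
  | .node p _ e c, d => DTree.node p (∑ j, match d j with
      | none => 0
      | some d' => {(e j, upper (c j) d')})

end PTree

end Trees

section CK
variable (K : Type*) [Field K] (P : Type*) (E : P → Type*)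

/-- The algebra of decorated forests: the commutative algebra freely generated by decorated rooted
trees.  The monomials are the forests, and multiplication is disjoint union. -/
def CK : Type _ := MvPolynomial (DTree P E) K

noncomputable instance : CommRing (CK K P E) := inferInstanceAs (CommRing (MvPolynomial _ K))
noncomputable instance : Algebra K (CK K P E) := inferInstanceAs (Algebra K (MvPolynomial _ K))

namespace CK
variable {P E}

/-- A tree as an element of the algebra. -/
noncomputable def tree (t : DTree P E) : CK K P E := (MvPolynomial.X t : MvPolynomial _ K)

/-- A forest as an element of the algebra. -/
noncomputable def forest (f : Multiset (DTree P E)) : CK K P E := (f.map (tree K)).prod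

/-- The algebra morphism with given values on trees. -/
noncomputable def lift {A : Type*} [CommRing A] [Algebra K A] (f : DTree P E → A) :
    CK K P E →ₐ[K] A :=
  (MvPolynomial.aeval f : MvPolynomial (DTree P E) K →ₐ[K] A)

@[simp] lemma lift_tree {A : Type*} [CommRing A] [Algebra K A] (f : DTree P E → A)
    (t : DTree P E) : lift K f (tree K t) = f t := MvPolynomial.aeval_X (R := K) _ _

variable {K} in
lemma hom_ext {A : Type*} [CommRing A] [Algebra K A] {f g : CK K P E →ₐ[K] A}
    (h : ∀ t, f (tree K t) = g (tree K t)) : f = g :=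
  MvPolynomial.algHom_ext (R := K) (σ := DTree P E) (f := f) (g := g) h

/-- The morphism `t ↦ (e, t)`, marking every tree with the edge decoration `e`. -/
noncomputable def colour (p : P) (e : E p) :
    CK K P E →ₐ[K] MvPolynomial (E p × DTree P E) K :=
  lift K fun t => MvPolynomial.X (e, t)

/-- The linear map sending a forest of trees marked by elements of `E p` to the tree obtained by
adding a new root decorated by `p`, joined to each component by an edge with the given mark. -/
noncomputable def graft (p : P) : MvPolynomial (E p × DTree P E) K →ₗ[K] CK K P E :=
  (MvPolynomial.basisMonomials _ K).constr K fun m => tree K (DTree.node p (Finsupp.toMultiset m))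

/-- `Δ t = ∑ D ⊗ (t \ D)` over all downsets `D` of the tree `t`: the downset `D = t` gives
`t ⊗ 1`, the others are those not containing the root. -/
noncomputable def comulPTree (t : PTree P E) : CK K P E ⊗[K] CK K P E :=
  tree K (DTree.mk t) ⊗ₜ 1 + ∑ d : t.Cut, forest K (t.lower d) ⊗ₜ[K] tree K (t.upper d)

lemma prod_map_X (p : P) [DecidableEq (E p × DTree P E)] (m : Multiset (E p × DTree P E)) :
    ((m.map MvPolynomial.X).prod : MvPolynomial (E p × DTree P E) K) =
      MvPolynomial.basisMonomials _ K (Multiset.toFinsupp m) := by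
  rw [MvPolynomial.coe_basisMonomials]
  induction m using Multiset.induction with
  | empty => simp
  | cons a s ih =>
    rw [Multiset.map_cons, Multiset.prod_cons, ih, ← Multiset.singleton_add, map_add,
      Multiset.toFinsupp_singleton, MvPolynomial.X, MvPolynomial.monomial_mul, one_mul]

lemma graft_prod (p : P) (m : Multiset (E p × DTree P E)) :
    graft K p (m.map MvPolynomial.X).prod = tree K (DTree.node p m) := by
  classical
  rw [prod_map_X, graft, Module.Basis.constr_basis, Multiset.toFinsupp_toMultiset]

lemma comulPTree_node (p : P) (n : ℕ) (e : Fin n → E p) (c : Fin n → PTree P E) :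
    comulPTree K (.node p n e c) = tree K (DTree.mk (.node p n e c)) ⊗ₜ 1 +
      (graft K p).lTensor (CK K P E)
        (∏ j, Algebra.TensorProduct.map (.id K (CK K P E)) (colour K p (e j))
          (comulPTree K (c j))) := by
  rw [comulPTree]
  congr 1
  let lo : ∀ j, Option (c j).Cut → Multiset (DTree P E) := fun j o => match o with
      | none => {DTree.mk (c j)}
      | some d' => (c j).lower d'
  let up : ∀ j, Option (c j).Cut → Multiset (E p × DTree P E) := fun j o => match o with
      | none => 0
      | some d' => {(e j, (c j).upper d')}
  have h : ∀ j, Algebra.TensorProduct.map (.id K (CK K P E)) (colour K p (e j))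
      (comulPTree K (c j)) = ∑ o : Option (c j).Cut,
        forest K (lo j o) ⊗ₜ[K] ((up j o).map MvPolynomial.X).prod := by
    intro j
    rw [comulPTree, Fintype.sum_option]
    simp [lo, up, forest, colour]
  rw [Finset.prod_congr rfl fun j _ => h j, Finset.prod_univ_sum, Fintype.piFinset_univ, map_sum]
  refine Fintype.sum_congr _ _ fun d => ?_
  have h2 : (∏ j, forest K (lo j (d j)) ⊗ₜ[K] ((up j (d j)).map MvPolynomial.X).prod :
      CK K P E ⊗[K] MvPolynomial (E p × DTree P E) K) =
      forest K (∑ j, lo j (d j)) ⊗ₜ[K] ((∑ j, up j (d j)).map MvPolynomial.X).prod := by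
    have h3 : ∀ s : Finset (Fin n),
        (∏ j ∈ s, forest K (lo j (d j)) ⊗ₜ[K] ((up j (d j)).map MvPolynomial.X).prod :
          CK K P E ⊗[K] MvPolynomial (E p × DTree P E) K) =
        forest K (∑ j ∈ s, lo j (d j)) ⊗ₜ[K]
          ((∑ j ∈ s, up j (d j)).map MvPolynomial.X).prod := by
      intro s
      induction s using Finset.cons_induction with
      | empty => simp [forest, Algebra.TensorProduct.one_def]
      | cons a s ha ih =>
        simp only [Finset.prod_cons, Finset.sum_cons, ih, Algebra.TensorProduct.tmul_mul_tmul]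
        simp [forest]
    exact h3 Finset.univ
  rw [h2, LinearMap.lTensor_tmul, graft_prod]
  rfl

lemma comulPTree_iso {t t' : PTree P E} (h : PTree.Iso t t') :
    comulPTree K t = comulPTree K t' := by
  induction h with
  | node p n m e c e' c' σ he hc ih =>
    rw [comulPTree_node, comulPTree_node]
    congr 2
    · exact congrArg _ (Quotient.sound (PTree.Iso.node p n m e c e' c' σ he hc))
    · refine Fintype.prod_equiv σ _ _ fun j => ?_
      rw [he, ih]

/-- The coproduct, as an algebra morphism: a downset of a forest is the union of a downset of each
of its trees. -/
noncomputable def comulHom : CK K P E →ₐ[K] CK K P E ⊗[K] CK K P E :=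
  lift K (Quotient.lift (s := PTree.setoid P E) (comulPTree K) fun _ _ => comulPTree_iso K)

/-- The counit, sending all nonempty forests to `0`. -/
noncomputable def counitHom : CK K P E →ₐ[K] K := lift K fun _ => 0

lemma comulHom_tree (t : PTree P E) :
    comulHom K (tree K (DTree.mk t)) = comulPTree K t := lift_tree K _ _

/-- The coaction on marked forests used to express the coproduct of a grafted tree. -/
noncomputable def coact (p : P) : MvPolynomial (E p × DTree P E) K →ₐ[K]
    CK K P E ⊗[K] MvPolynomial (E p × DTree P E) K :=
  MvPolynomial.aeval fun x => Algebra.TensorProduct.map (.id K (CK K P E)) (colour K p x.1)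
    (comulHom K (tree K x.2))

lemma mk_node' (p : P) (n : ℕ) (e : Fin n → E p) (c : Fin n → PTree P E) :
    tree K (DTree.mk (.node p n e c)) =
      graft K p (∏ j, MvPolynomial.X (e j, DTree.mk (c j))) := by
  rw [DTree.mk_node, ← graft_prod, Multiset.map_map]
  rfl

lemma comulHom_graft_prod (p : P) (n : ℕ) (e : Fin n → E p) (c : Fin n → PTree P E) :
    comulHom K (graft K p (∏ j, MvPolynomial.X (e j, DTree.mk (c j)))) =
      graft K p (∏ j, MvPolynomial.X (e j, DTree.mk (c j))) ⊗ₜ 1 +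
      (graft K p).lTensor (CK K P E) (coact K p (∏ j, MvPolynomial.X (e j, DTree.mk (c j)))) := by
  rw [← mk_node', comulHom_tree, comulPTree_node]
  simp [coact, comulHom_tree]

lemma comulHom_graft (p : P) (x : MvPolynomial (E p × DTree P E) K) :
    comulHom K (graft K p x) =
      graft K p x ⊗ₜ 1 + (graft K p).lTensor (CK K P E) (coact K p x) := by
  classical
  suffices h : (comulHom K).toLinearMap ∘ₗ graft K p =
      (TensorProduct.mk K (CK K P E) (CK K P E)).flip 1 ∘ₗ graft K p +
        (graft K p).lTensor (CK K P E) ∘ₗ (coact K p).toLinearMap from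
    DFunLike.congr_fun h x
  refine (MvPolynomial.basisMonomials _ K).ext fun m => ?_
  have hm : MvPolynomial.basisMonomials (E p × DTree P E) K m =
      ∏ j : Fin (Finsupp.toMultiset m).toList.length,
        MvPolynomial.X (((Finsupp.toMultiset m).toList.get j).1,
          DTree.mk ((Finsupp.toMultiset m).toList.get j).2.out) := by
    simp only [DTree.mk_out, Prod.mk.eta]
    refine Eq.trans ?_ (Fin.prod_univ_fun_getElem (Finsupp.toMultiset m).toList
      (MvPolynomial.X : _ → MvPolynomial (E p × DTree P E) K)).symm
    rw [← Multiset.prod_coe, ← Multiset.map_coe, Multiset.coe_toList, prod_map_X,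
      Finsupp.toMultiset_toFinsupp]
  rw [hm]
  exact comulHom_graft_prod K p _ _ _

lemma coact_colour (p : P) (e : E p) :
    (coact K p).comp (colour K p e) =
      (Algebra.TensorProduct.map (.id K (CK K P E)) (colour K p e)).comp (comulHom K) :=
  hom_ext fun t => by simp [coact, colour]

lemma coassoc_tree : ∀ t : PTree P E,
    Algebra.TensorProduct.assoc K K K (CK K P E) (CK K P E) (CK K P E)
      (Algebra.TensorProduct.map (comulHom K) (.id K (CK K P E))
        (comulHom K (tree K (DTree.mk t)))) =
    Algebra.TensorProduct.map (.id K (CK K P E)) (comulHom K)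
      (comulHom K (tree K (DTree.mk t)))
  | .node p n e c => by
    have ih := fun j => coassoc_tree (c j)
    set a : MvPolynomial (E p × DTree P E) K := ∏ j, MvPolynomial.X (e j, DTree.mk (c j)) with ha
    have hco : Algebra.TensorProduct.assoc K K K (CK K P E) (CK K P E) _
          (Algebra.TensorProduct.map (comulHom K) (.id K _) (coact K p a)) =
        Algebra.TensorProduct.map (.id K (CK K P E)) (coact K p) (coact K p a) := by
      rw [ha]
      simp only [map_prod]
      refine Finset.prod_congr rfl fun j _ => ?_
      have h1 : coact K p (MvPolynomial.X (e j, DTree.mk (c j))) =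
          Algebra.TensorProduct.map (.id K (CK K P E)) (colour K p (e j))
            (comulHom K (tree K (DTree.mk (c j)))) := by simp [coact]
      rw [h1]
      have h2 := congrArg (Algebra.TensorProduct.map (.id K (CK K P E))
        (Algebra.TensorProduct.map (.id K (CK K P E)) (colour K p (e j)))) (ih j)
      have e1 : ∀ x : CK K P E ⊗[K] CK K P E,
          Algebra.TensorProduct.assoc K K K (CK K P E) (CK K P E) _
            (Algebra.TensorProduct.map (comulHom K) (.id K _)
              (Algebra.TensorProduct.map (.id K (CK K P E)) (colour K p (e j)) x)) =
          Algebra.TensorProduct.map (.id K (CK K P E))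
            (Algebra.TensorProduct.map (.id K (CK K P E)) (colour K p (e j)))
            (Algebra.TensorProduct.assoc K K K (CK K P E) (CK K P E) (CK K P E)
              (Algebra.TensorProduct.map (comulHom K) (.id K (CK K P E)) x)) := by
        intro x
        induction x with
        | zero => simp
        | add x y hx hy => simp only [map_add, hx, hy]
        | tmul x y =>
          simp only [Algebra.TensorProduct.map_tmul, AlgHom.coe_id, id]
          induction comulHom K x with
          | zero => simp
          | add x y hx hy => simp only [map_add, TensorProduct.add_tmul, hx, hy]
          | tmul x z => simp
      have e2 : ∀ x : CK K P E ⊗[K] CK K P E,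
          Algebra.TensorProduct.map (.id K (CK K P E)) (coact K p)
            (Algebra.TensorProduct.map (.id K (CK K P E)) (colour K p (e j)) x) =
          Algebra.TensorProduct.map (.id K (CK K P E))
            (Algebra.TensorProduct.map (.id K (CK K P E)) (colour K p (e j)))
            (Algebra.TensorProduct.map (.id K (CK K P E)) (comulHom K) x) := by
        intro x
        induction x with
        | zero => simp
        | add x y hx hy => simp only [map_add, hx, hy]
        | tmul x y =>
          simp only [Algebra.TensorProduct.map_tmul, AlgHom.coe_id, id]
          exact congrArg _ (DFunLike.congr_fun (coact_colour K p (e j)) y)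
      rw [e1, h2, e2]
    have hΔ := comulHom_graft_prod K p n e c
    rw [← ha] at hΔ
    have f1 : ∀ x : CK K P E ⊗[K] MvPolynomial (E p × DTree P E) K,
        Algebra.TensorProduct.assoc K K K (CK K P E) (CK K P E) (CK K P E)
          (Algebra.TensorProduct.map (comulHom K) (.id K (CK K P E))
            ((graft K p).lTensor (CK K P E) x)) =
        ((graft K p).lTensor (CK K P E)).lTensor (CK K P E)
          (Algebra.TensorProduct.assoc K K K (CK K P E) (CK K P E) _
            (Algebra.TensorProduct.map (comulHom K) (.id K _) x)) := by
      intro x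
      induction x with
      | zero => simp
      | add x y hx hy => simp only [map_add, hx, hy]
      | tmul x y =>
        simp only [Algebra.TensorProduct.map_tmul, AlgHom.coe_id, id, LinearMap.lTensor_tmul]
        induction comulHom K x with
        | zero => simp
        | add x y hx hy => simp only [map_add, TensorProduct.add_tmul, hx, hy]
        | tmul x z => simp
    have f2 : ∀ x : CK K P E ⊗[K] MvPolynomial (E p × DTree P E) K,
        Algebra.TensorProduct.map (.id K (CK K P E)) (comulHom K)
          ((graft K p).lTensor (CK K P E) x) =
        Algebra.TensorProduct.assoc K K K (CK K P E) (CK K P E) (CK K P E)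
          ((graft K p).lTensor (CK K P E) x ⊗ₜ 1) +
        ((graft K p).lTensor (CK K P E)).lTensor (CK K P E)
          (Algebra.TensorProduct.map (.id K (CK K P E)) (coact K p) x) := by
      intro x
      induction x with
      | zero => simp
      | add x y hx hy =>
        simp only [map_add, TensorProduct.add_tmul, hx, hy]
        abel
      | tmul x y => simp [comulHom_graft, TensorProduct.tmul_add]
    rw [mk_node', ← ha, hΔ]
    simp only [map_add, f1, f2, hco, Algebra.TensorProduct.map_tmul, hΔ, map_one, AlgHom.coe_id,
      id, TensorProduct.add_tmul, Algebra.TensorProduct.assoc_tmul, Algebra.TensorProduct.one_def]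
    abel

lemma counit_graft (p : P) (x : MvPolynomial (E p × DTree P E) K) :
    counitHom K (graft K p x) = 0 := by
  suffices h : (counitHom K).toLinearMap ∘ₗ graft K p = 0 from DFunLike.congr_fun h x
  refine (MvPolynomial.basisMonomials _ K).ext fun m => ?_
  rw [LinearMap.comp_apply, graft, Module.Basis.constr_basis]
  exact lift_tree K _ _

lemma rTensor_counit_tree : ∀ t : PTree P E,
    Algebra.TensorProduct.map (counitHom K) (.id K (CK K P E))
      (comulHom K (tree K (DTree.mk t))) = 1 ⊗ₜ tree K (DTree.mk t)
  | .node p n e c => by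
    have ih := fun j => rTensor_counit_tree (c j)
    have hΔ := comulHom_graft_prod K p n e c
    set a : MvPolynomial (E p × DTree P E) K := ∏ j, MvPolynomial.X (e j, DTree.mk (c j)) with ha
    have hco : Algebra.TensorProduct.map (counitHom K) (.id K _) (coact K p a) = 1 ⊗ₜ a := by
      have h0 : ∀ b : MvPolynomial (E p × DTree P E) K, (1 : K) ⊗ₜ[K] b =
          Algebra.TensorProduct.includeRight b := fun b => rfl
      rw [ha, h0]
      simp only [map_prod]
      refine Finset.prod_congr rfl fun j _ => ?_
      have h1 : coact K p (MvPolynomial.X (e j, DTree.mk (c j))) =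
          Algebra.TensorProduct.map (.id K (CK K P E)) (colour K p (e j))
            (comulHom K (tree K (DTree.mk (c j)))) := by simp [coact]
      have e1 : ∀ x : CK K P E ⊗[K] CK K P E,
          Algebra.TensorProduct.map (counitHom K) (.id K _)
            (Algebra.TensorProduct.map (.id K (CK K P E)) (colour K p (e j)) x) =
          Algebra.TensorProduct.map (.id K K) (colour K p (e j))
            (Algebra.TensorProduct.map (counitHom K) (.id K (CK K P E)) x) := by
        intro x
        induction x with
        | zero => simp
        | add x y hx hy => simp only [map_add, hx, hy]
        | tmul x y => simp
      rw [h1, e1, ih j]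
      simp [colour]
    have f1 : ∀ x : CK K P E ⊗[K] MvPolynomial (E p × DTree P E) K,
        Algebra.TensorProduct.map (counitHom K) (.id K (CK K P E))
          ((graft K p).lTensor (CK K P E) x) =
        (graft K p).lTensor K (Algebra.TensorProduct.map (counitHom K) (.id K _) x) := by
      intro x
      induction x with
      | zero => simp
      | add x y hx hy => simp only [map_add, hx, hy]
      | tmul x y => simp
    rw [mk_node', ← ha, hΔ, map_add, f1, hco]
    simp [counit_graft]

lemma lTensor_counit_tree : ∀ t : PTree P E,
    Algebra.TensorProduct.map (.id K (CK K P E)) (counitHom K)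
      (comulHom K (tree K (DTree.mk t))) = tree K (DTree.mk t) ⊗ₜ 1
  | .node p n e c => by
    have f1 : ∀ x : CK K P E ⊗[K] MvPolynomial (E p × DTree P E) K,
        Algebra.TensorProduct.map (.id K (CK K P E)) (counitHom K)
          ((graft K p).lTensor (CK K P E) x) = 0 := by
      intro x
      induction x with
      | zero => simp
      | add x y hx hy => simp only [map_add, hx, hy, add_zero]
      | tmul x y => simp [counit_graft]
    rw [mk_node', comulHom_graft, map_add, f1]
    simp

noncomputable instance : Bialgebra K (CK K P E) :=
  Bialgebra.ofAlgHom (comulHom K) (counitHom K)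
    (hom_ext fun t => by
      obtain ⟨t, rfl⟩ := Quotient.exists_rep (s := PTree.setoid P E) t
      exact coassoc_tree K t)
    (hom_ext fun t => by
      obtain ⟨t, rfl⟩ := Quotient.exists_rep (s := PTree.setoid P E) t
      exact rTensor_counit_tree K t)
    (hom_ext fun t => by
      obtain ⟨t, rfl⟩ := Quotient.exists_rep (s := PTree.setoid P E) t
      exact lTensor_counit_tree K t)

/-- The grafting operator `B₊ p : H ^ ⊗ E p → H`, which sends `⨂ e, f e`, for forests `f e`, to the
tree with a new root decorated by `p` joined to each component of `f e` by an edge decorated by `e`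
(see `Bplus_tprod`). -/
noncomputable def Bplus (p : P) [Fintype (E p)] :
    (⨂[K] _ : E p, CK K P E) →ₗ[K] CK K P E :=
  graft K p ∘ₗ PiTensorProduct.lift
    ((MultilinearMap.mkPiAlgebra K (E p) (MvPolynomial (E p × DTree P E) K)).compLinearMap
      fun e => (colour K p e).toLinearMap)

lemma Bplus_tprod (p : P) [Fintype (E p)] (f : E p → Multiset (DTree P E)) :
    Bplus K p (PiTensorProduct.tprod K fun e => forest K (f e)) =
      tree K (DTree.node p (∑ e, (f e).map fun t => (e, t))) := by
  rw [← graft_prod]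
  simp only [Bplus, LinearMap.comp_apply, PiTensorProduct.lift.tprod,
    MultilinearMap.compLinearMap_apply, MultilinearMap.mkPiAlgebra_apply]
  congr 1
  have h : ∀ s : Finset (E p), ∏ e ∈ s, (colour K p e).toLinearMap (forest K (f e)) =
      ((∑ e ∈ s, (f e).map fun t => (e, t)).map MvPolynomial.X).prod := by
    intro s
    induction s using Finset.cons_induction with
    | empty => simp
    | cons a s ha ih => 
      rw [Finset.prod_cons, ih, Finset.sum_cons, Multiset.map_add, Multiset.prod_add]
      simp [forest, colour, map_multiset_prod, Multiset.map_map]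
  exact h Finset.univ

end CK
end CK
section Systems

open PowerSeries (coeff map)

/-- `F(x) ^ a = ∑ k, (a choose k) (F(x) - 1) ^ k`, for a power series `F` with constant term `1` over
a commutative `K`-algebra and an exponent `a ∈ K`. -/
noncomputable def cpow {K A : Type*} [Field K] [CharZero K] [CommRing A] [Algebra K A]
    (F : PowerSeries A) (a : K) : PowerSeries A :=
  (PowerSeries.binomialSeries A a).subst (F - 1)

/-- `F(x) ^ μ = ∏ j, F j(x) ^ μ j`, for vectors `F` of series and `μ` of exponents. -/
noncomputable def vecPow {K A I : Type*} [Field K] [CharZero K] [CommRing A] [Algebra K A]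
    [Fintype I] (F : I → PowerSeries A) (μ : I → K) : PowerSeries A :=
  ∏ j, cpow (F j) (μ j)

/-- The invariant charge `Q(x) = x ∏ j, T j(x) ^ s j`. -/
noncomputable def invCharge {K A I : Type*} [Field K] [CharZero K] [CommRing A] [Algebra K A]
    [Fintype I] (s : I → K) (T : I → PowerSeries A) : PowerSeries A :=
  PowerSeries.X * vecPow T s

/-- A linear map applied to a power series coefficientwise. -/
noncomputable def applySeries {K M N : Type*} [Field K] [CommRing M] [Algebra K M] [CommRing N]
    [Algebra K N] (Λ : M →ₗ[K] N) (F : PowerSeries M) : PowerSeries N :=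
  PowerSeries.mk fun n => Λ (coeff n F)

/-- The sum of a family of power series, in which each power of `x` occurs only finitely often. -/
noncomputable def sumSeries {ι A : Type*} [CommRing A] (F : ι → PowerSeries A) : PowerSeries A :=
  PowerSeries.mk fun n => ∑ᶠ i, coeff n (F i)

/-- The series `⨂ e, F e(x)` with coefficients in the tensor power. -/
noncomputable def tensorSeries (K : Type*) {A ε : Type*} [Field K] [CommRing A] [Algebra K A]
    [Fintype ε] [DecidableEq ε] (F : ε → PowerSeries A) : PowerSeries (⨂[K] _ : ε, A) :=
  ∏ e, map (PiTensorProduct.singleAlgHom (R := K) (A := fun _ : ε => A) e).toRingHom (F e)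

/-- The series `∏ e, F e(x, L_e)` with coefficients in `K[L_e : e ∈ ε]`, for series `F e(x, L)` with
coefficients in `K[L]`. -/
noncomputable def multiScale {K ε : Type*} [Field K] [Fintype ε]
    (F : ε → PowerSeries (Polynomial K)) : PowerSeries (MvPolynomial ε K) :=
  ∏ e, map (Polynomial.aeval (R := K) (MvPolynomial.X (R := K) e)).toRingHom (F e)

/-- A linear map `Λ : M → H` is a 1-cocycle on the left `H`-comodule `M` with coaction `δ` if
`Δ Λ = Λ ⊗ 1 + (id ⊗ Λ) δ`. -/
def IsOneCocycle {K H M : Type*} [Field K] [CommRing H] [Bialgebra K H] [AddCommGroup M]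
    [Module K M] (δ : M →ₗ[K] H ⊗[K] M) (Λ : M →ₗ[K] H) : Prop :=
  ∀ m, Coalgebra.comul (R := K) (Λ m) = Λ m ⊗ₜ[K] 1 + Λ.lTensor H (δ m)

/-- The coaction of `K[L]` on `K[L_e : e ∈ ε] = K[L] ^ ⊗ ε`, with `δ L_e = L ⊗ 1 + 1 ⊗ L_e`. -/
noncomputable def polyCoaction (K ε : Type*) [Field K] :
    MvPolynomial ε K →ₐ[K] Polynomial K ⊗[K] MvPolynomial ε K :=
  MvPolynomial.aeval fun e => Polynomial.X ⊗ₜ[K] 1 + 1 ⊗ₜ[K] MvPolynomial.X e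

variable {K P I : Type*} {E : P → Type*} [Field K] [CharZero K] [Fintype I]
  [∀ p, Fintype (E p)] [∀ p, DecidableEq (E p)]

/-- The combinatorial Dyson-Schwinger system
`T i(x) = 1 + ∑ p ∈ P_i, x ^ w p B₊ p (⨂ e ∈ E p, T(x) ^ μ e)`, where `P_i` is the set of the `p`
with `part p = i`. -/
def IsCombSolution (part : P → I) (w : P → ℕ) (μ : ∀ p, E p → I → K)
    (T : I → PowerSeries (CK K P E)) : Prop :=
  ∀ i, T i = 1 + sumSeries fun p : {p // part p = i} =>
    PowerSeries.X ^ w p.1 *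
      applySeries (CK.Bplus K p.1) (tensorSeries K fun e => vecPow T (μ p.1 e))

/-- The combinatorial Dyson-Schwinger system written with the invariant charge `Q`:
`T i(x) = 1 + ∑ p ∈ P_i, B₊ p (⨂ e ∈ E p, T i(x) ^ u e Q(x) ^ α e)`. -/
def IsCombSolutionQ (part : P → I) (u : ∀ p, E p → K) (α : ∀ p, E p → ℕ) (s : I → K)
    (T : I → PowerSeries (CK K P E)) : Prop :=
  ∀ i, T i = 1 + sumSeries fun p : {p // part p = i} =>
    applySeries (CK.Bplus K p.1)
      (tensorSeries K fun e => cpow (T i) (u p.1 e) * invCharge s T ^ α p.1 e)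

/-- The Dyson-Schwinger system
`G i(x, L) = 1 + ∑ p ∈ P_i, x ^ w p Λ p (∏ e ∈ E p, G(x, L_e) ^ μ e)`. -/
def IsDSESolution (part : P → I) (w : P → ℕ) (μ : ∀ p, E p → I → K)
    (Λ : ∀ p, MvPolynomial (E p) K →ₗ[K] Polynomial K)
    (G : I → PowerSeries (Polynomial K)) : Prop :=
  ∀ i, G i = 1 + sumSeries fun p : {p // part p = i} =>
    PowerSeries.X ^ w p.1 * applySeries (Λ p.1) (multiScale fun e => vecPow G (μ p.1 e))

/-- The coefficient of `L` in a series `F(x, L)`. -/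
noncomputable def linL {K : Type*} [Field K] (F : PowerSeries (Polynomial K)) : PowerSeries K :=
  PowerSeries.mk fun n => (coeff n F).coeff 1

/-- The renormalization group equation `(∂/∂L - β(x) ∂/∂x - γ(x)) F(x, L) = 0`. -/
def SatisfiesRGE {K : Type*} [Field K] (β γ : PowerSeries K) (F : PowerSeries (Polynomial K)) :
    Prop :=
  applySeries (K := K) Polynomial.derivative F
    - map Polynomial.C β * PowerSeries.derivative (Polynomial K) F
    - map Polynomial.C γ * F = 0

end Systems

end DysonSchwinger

open DysonSchwinger

set_option linter.unusedSectionVars false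

/-! Both Dyson–Schwinger systems are fixed-point equations `F = dsMap … 1 F` over a commutative
`K`-algebra, with maps `ι p e` placing a factor at the insertion place `e` and linear maps `Λ p`.
For trees, `ι` is `CK.colour` and `Λ` is `CK.graft`; for `K[L]`, `ι` substitutes `L_e` for `L`.
Since every weight is at least 1, `dsMap` is a contraction for the `X`-adic topology, so there is
exactly one solution (`exists_dsMap_fixed`, `dsMap_unique`).

The heart is the coproduct formula `map_comul_eq_tensorComp`: over a bialgebra, if each `Λ p` is a
1-cocycle, then `Δ F_i(x) = (F_i(x) ⊗ 1) · (1 ⊗ F_i)(Q(x) ⊗ 1)`. Both sides solve one and the same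
system over `H ⊗ H`, with `Λ p` replaced by `id ⊗ Λ p` and inhomogeneous term `F_i ⊗ 1`. For the
left side this is the cocycle identity (`map_comul_dsTerm`). For the right side it rests on `∑ e,
μ_e = 1_i + w_p s`, by which the left tensor factors of a summand multiply, together with `x ^ w_p`,
to `F_i Q ^ w_p` (`dsTerm_tensorComp`). Uniqueness concludes.

Binomial powers carry the formula over to `Q`, giving `Δ Q = (1 ⊗ Q)(Q ⊗ 1)`. These are the
coproducts of `Y` and `Π` in the Riordan bialgebra, whence the morphisms of part (1). For part (2),
extracting the coefficient of `L` in the left tensor factor turns `Δ` into `∂/∂L`, and the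
composition with `Q` into `β ∂/∂x + γ_i`, where `β` is the `L`-coefficient of `Q`
(`satisfiesRGE_of_map_comul`). -/

namespace DysonSchwinger

open PowerSeries (coeff map constantCoeff)
open Algebra.TensorProduct (includeLeft includeRight)

/-! ### Binomial powers of series with constant term 1 -/

section BinomialPowers

lemma coeff_subst_of_constantCoeff_zero {A : Type*} [CommRing A] {Q : PowerSeries A}
    (hQ : constantCoeff Q = 0) (g : PowerSeries A) (n : ℕ) :
    coeff n (g.subst Q) = ∑ d ∈ Finset.range (n + 1), coeff d g * coeff n (Q ^ d) := by
  rw [PowerSeries.coeff_subst' (PowerSeries.HasSubst.of_constantCoeff_zero' hQ),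
    finsum_eq_sum_of_support_subset (s := Finset.range (n + 1))]
  · simp
  · intro d hd
    by_contra hn
    apply hd
    have hlt : n < d := by simpa using hn
    obtain ⟨R, hR⟩ := PowerSeries.X_dvd_iff.2 hQ
    show _ • _ = _
    rw [hR, mul_pow, PowerSeries.coeff_X_pow_mul']
    simp [hlt.not_ge]

variable {K A B I : Type*} [Field K] [CharZero K] [CommRing A] [Algebra K A] [CommRing B]
  [Algebra K B]

lemma constantCoeff_sub_one {F : PowerSeries A} (hF : constantCoeff F = 1) :
    constantCoeff (F - 1) = 0 := by simp [hF]

lemma hasSubst_sub_one {F : PowerSeries A} (hF : constantCoeff F = 1) :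
    PowerSeries.HasSubst (F - 1) :=
  PowerSeries.HasSubst.of_constantCoeff_zero' (constantCoeff_sub_one hF)

lemma coeff_cpow {F : PowerSeries A} (hF : constantCoeff F = 1) (a : K) (n : ℕ) :
    coeff n (cpow F a) =
      ∑ k ∈ Finset.range (n + 1), Ring.choose a k • coeff n ((F - 1) ^ k) := by
  rw [cpow, coeff_subst_of_constantCoeff_zero (constantCoeff_sub_one hF)]
  simp

lemma constantCoeff_cpow {F : PowerSeries A} (hF : constantCoeff F = 1) (a : K) :
    constantCoeff (cpow F a) = 1 := by
  rw [← PowerSeries.coeff_zero_eq_constantCoeff_apply, coeff_cpow hF]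
  simp

lemma cpow_add {F : PowerSeries A} (hF : constantCoeff F = 1) (a b : K) :
    cpow F (a + b) = cpow F a * cpow F b := by
  rw [cpow, PowerSeries.binomialSeries_add, PowerSeries.subst_mul (hasSubst_sub_one hF)]
  rfl

lemma cpow_natCast {F : PowerSeries A} (hF : constantCoeff F = 1) (d : ℕ) :
    cpow F (d : K) = F ^ d := by
  rw [cpow, PowerSeries.binomialSeries_nat, ← PowerSeries.coe_substAlgHom (hasSubst_sub_one hF),
    map_pow, map_add, map_one, PowerSeries.substAlgHom_X]
  exact congrArg (· ^ d) (add_sub_cancel 1 F)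

lemma cpow_zero {F : PowerSeries A} (hF : constantCoeff F = 1) : cpow F (0 : K) = 1 := by
  simpa using cpow_natCast (K := K) hF 0

lemma cpow_one {F : PowerSeries A} (hF : constantCoeff F = 1) : cpow F (1 : K) = F := by
  simpa using cpow_natCast (K := K) hF 1

lemma one_cpow (a : K) : cpow (1 : PowerSeries A) a = 1 := by
  ext n
  rw [coeff_cpow (by simp), Finset.sum_range_succ']
  simp

lemma constantCoeff_map_eq_one {R S : Type*} [CommRing R] [CommRing S] (f : R →+* S)
    {F : PowerSeries R} (hF : constantCoeff F = 1) : constantCoeff (map f F) = 1 := by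
  rw [← PowerSeries.coeff_zero_eq_constantCoeff_apply, PowerSeries.coeff_map,
    PowerSeries.coeff_zero_eq_constantCoeff_apply, hF, map_one]

lemma map_cpow (f : A →ₐ[K] B) {F : PowerSeries A} (hF : constantCoeff F = 1) (a : K) :
    map f.toRingHom (cpow F a) = cpow (map f.toRingHom F) a := by
  ext n
  rw [PowerSeries.coeff_map, coeff_cpow hF, coeff_cpow (constantCoeff_map_eq_one _ hF),
    map_sum]
  refine Finset.sum_congr rfl fun k _ => ?_
  rw [← map_one (map f.toRingHom), ← map_sub, ← map_pow, PowerSeries.coeff_map]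
  exact map_smul f _ _

lemma subst_one_eq {Q : PowerSeries A} (hQ : constantCoeff Q = 0) :
    (1 : PowerSeries A).subst Q = 1 := by
  rw [← PowerSeries.coe_substAlgHom (PowerSeries.HasSubst.of_constantCoeff_zero' hQ), map_one]

lemma constantCoeff_subst_of_constantCoeff_zero {Q : PowerSeries A} (hQ : constantCoeff Q = 0)
    (F : PowerSeries A) : constantCoeff (F.subst Q : PowerSeries A) = constantCoeff F := by
  rw [← PowerSeries.coeff_zero_eq_constantCoeff_apply, coeff_subst_of_constantCoeff_zero hQ]
  simp

lemma cpow_subst {F Q : PowerSeries A} (hF : constantCoeff F = 1) (hQ : constantCoeff Q = 0)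
    (a : K) : (cpow F a).subst Q = cpow (F.subst Q : PowerSeries A) a := by
  rw [cpow, cpow, PowerSeries.subst_comp_subst_apply (hasSubst_sub_one hF)
    (PowerSeries.HasSubst.of_constantCoeff_zero' hQ),
    PowerSeries.subst_sub (PowerSeries.HasSubst.of_constantCoeff_zero' hQ), subst_one_eq hQ]

/-- `A` may have zero divisors, so counting roots is not available. Instead the root `m` is split
off: for `n > m` the difference `n - m` is a nonzero scalar of `K`, hence a unit in `A`, so the
quotient vanishes at all `n ≥ m + 1` and induction on the degree bound applies. -/
lemma eq_zero_of_eval_natCast [Nontrivial A] : ∀ (N m : ℕ) (p : Polynomial A), p.natDegree < N →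
    (∀ n : ℕ, m ≤ n → p.eval (algebraMap K A n) = 0) → p = 0
  | 0, _, _, h, _ => by omega
  | N + 1, m, p, hN, h => by
    obtain ⟨q, rfl⟩ := Polynomial.dvd_iff_isRoot.2 (h m le_rfl)
    by_cases hq : q = 0
    · simp [hq]
    have hdeg : ((Polynomial.X - Polynomial.C (algebraMap K A m)) * q).natDegree =
        1 + q.natDegree := by
      rw [(Polynomial.monic_X_sub_C _).natDegree_mul' hq, Polynomial.natDegree_X_sub_C]
    refine absurd (eq_zero_of_eval_natCast N (m + 1) q (by omega) fun n hn => ?_) hq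
    have h0 := h n (by omega)
    rw [Polynomial.eval_mul, Polynomial.eval_sub, Polynomial.eval_X, Polynomial.eval_C,
      ← map_sub] at h0
    have hne : (n : K) - m ≠ 0 := sub_ne_zero.2 (by exact_mod_cast (show n ≠ m by omega))
    exact ((hne.isUnit.map (algebraMap K A)).mul_right_eq_zero).1 h0

/-- Functions given by a polynomial with coefficients in the algebra `A`. -/
def IsPolyFun (f : K → A) : Prop :=
  ∃ p : Polynomial A, ∀ a, f a = p.eval (algebraMap K A a)

/-- The principle by which power laws known for natural exponents extend to exponents in `K`. -/
lemma IsPolyFun.eq_of_natCast {f g : K → A} (hf : IsPolyFun f) (hg : IsPolyFun g)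
    (h : ∀ n : ℕ, f n = g n) : f = g := by
  cases subsingleton_or_nontrivial A
  · exact Subsingleton.elim _ _
  obtain ⟨p, hp⟩ := hf
  obtain ⟨q, hq⟩ := hg
  have h0 : p - q = 0 := eq_zero_of_eval_natCast (K := K) _ 0 (p - q) (Nat.lt_succ_self _)
    fun n _ => by rw [Polynomial.eval_sub, ← hp, ← hq, h, sub_self]
  funext a
  rw [hp, hq, sub_eq_zero.1 h0]

lemma IsPolyFun.sum {ι : Type*} (t : Finset ι) {f : ι → K → A} (h : ∀ j ∈ t, IsPolyFun (f j)) :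
    IsPolyFun fun a => ∑ j ∈ t, f j a := by
  choose! p hp using h
  exact ⟨∑ j ∈ t, p j, fun a => by
    rw [Polynomial.eval_finsetSum]; exact Finset.sum_congr rfl fun j hj => hp j hj a⟩

lemma IsPolyFun.mul {f g : K → A} (hf : IsPolyFun f) (hg : IsPolyFun g) :
    IsPolyFun fun a => f a * g a := by
  obtain ⟨p, hp⟩ := hf
  obtain ⟨q, hq⟩ := hg
  exact ⟨p * q, fun a => by simp only [Polynomial.eval_mul, hp, hq]⟩

/-- The polynomial is the falling factorial divided by `k!`, which is where characteristic zero
enters. -/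
lemma isPolyFun_choose_smul (k : ℕ) (v : A) : IsPolyFun fun a : K => Ring.choose a k • v := by
  refine ⟨Polynomial.C v * (Polynomial.C ((k.factorial : K)⁻¹) *
    (descPochhammer K k)).map (algebraMap K A), fun a => ?_⟩
  rw [Polynomial.eval_mul, Polynomial.eval_C, Polynomial.eval_map, Polynomial.eval₂_at_apply]
  simp only [Ring.choose_eq_smul, Algebra.smul_def, mul_comm v]
  congr 2
  rw [Polynomial.eval_mul, Polynomial.eval_C]
  rw [← Polynomial.aeval_eq_smeval, Polynomial.aeval_def, Polynomial.eval₂_eq_eval_map,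
    algebraMap_int_eq, descPochhammer_map, Algebra.algebraMap_self_apply]

lemma isPolyFun_coeff_cpow {F : PowerSeries A} (hF : constantCoeff F = 1) (n : ℕ) :
    IsPolyFun fun a : K => coeff n (cpow F a) := by
  simp only [coeff_cpow hF]
  exact .sum _ fun k _ => isPolyFun_choose_smul k _

/-- Each coefficient of either side is polynomial in the exponent, and for natural exponents the
identity is `mul_pow`. -/
lemma mul_cpow {F G : PowerSeries A} (hF : constantCoeff F = 1) (hG : constantCoeff G = 1)
    (a : K) : cpow (F * G) a = cpow F a * cpow G a := by
  have hFG : constantCoeff (F * G) = 1 := by simp [hF, hG]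
  ext n
  refine congrFun ((isPolyFun_coeff_cpow (K := K) hFG n).eq_of_natCast
    (g := fun a => coeff n (cpow F a * cpow G a)) ?_ fun d => ?_) a
  · simp only [PowerSeries.coeff_mul]
    exact .sum _ fun k _ => (isPolyFun_coeff_cpow hF _).mul (isPolyFun_coeff_cpow hG _)
  · rw [cpow_natCast hFG, cpow_natCast hF, cpow_natCast hG, mul_pow]

lemma cpow_congr {F G : PowerSeries A} (hF : constantCoeff F = 1) (hG : constantCoeff G = 1)
    (a : K) {n : ℕ} (h : PowerSeries.X ^ n ∣ F - G) :
    PowerSeries.X ^ n ∣ cpow F a - cpow G a := by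
  rw [PowerSeries.X_pow_dvd_iff]
  intro m hm
  rw [map_sub, coeff_cpow hF, coeff_cpow hG, ← Finset.sum_sub_distrib]
  refine Finset.sum_eq_zero fun k _ => ?_
  have h1 : PowerSeries.X ^ n ∣ (F - 1) ^ k - (G - 1) ^ k :=
    dvd_trans (by simpa using h) (sub_dvd_pow_sub_pow (F - 1) (G - 1) k)
  rw [← smul_sub, ← map_sub, PowerSeries.X_pow_dvd_iff.1 h1 m hm, smul_zero]

/-- The products agree in the quotient by the ideal generated by `d`. -/
lemma dvd_prod_sub_prod {R ι : Type*} [CommRing R] (d : R) (t : Finset ι) {f g : ι → R}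
    (h : ∀ j ∈ t, d ∣ f j - g j) : d ∣ ∏ j ∈ t, f j - ∏ j ∈ t, g j := by
  rw [← Ideal.mem_span_singleton, ← Ideal.Quotient.mk_eq_mk_iff_sub_mem, map_prod, map_prod]
  refine Finset.prod_congr rfl fun j hj => ?_
  rw [Ideal.Quotient.mk_eq_mk_iff_sub_mem, Ideal.mem_span_singleton]
  exact h j hj

variable [Fintype I]

lemma constantCoeff_vecPow {F : I → PowerSeries A} (hF : ∀ i, constantCoeff (F i) = 1)
    (μ : I → K) : constantCoeff (vecPow F μ) = 1 := by
  rw [vecPow, map_prod]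
  exact Finset.prod_eq_one fun j _ => constantCoeff_cpow (hF j) _

lemma vecPow_congr {F G : I → PowerSeries A} (hF : ∀ i, constantCoeff (F i) = 1)
    (hG : ∀ i, constantCoeff (G i) = 1) (μ : I → K) {n : ℕ}
    (h : ∀ i, PowerSeries.X ^ n ∣ F i - G i) :
    PowerSeries.X ^ n ∣ vecPow F μ - vecPow G μ :=
  dvd_prod_sub_prod _ _ fun j _ => cpow_congr (hF j) (hG j) _ (h j)

lemma map_vecPow (f : A →ₐ[K] B) {F : I → PowerSeries A} (hF : ∀ i, constantCoeff (F i) = 1)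
    (μ : I → K) :
    map f.toRingHom (vecPow F μ) = vecPow (fun i => map f.toRingHom (F i)) μ := by
  rw [vecPow, map_prod]
  exact Finset.prod_congr rfl fun j _ => map_cpow f (hF j) _

lemma vecPow_subst {F : I → PowerSeries A} {Q : PowerSeries A}
    (hF : ∀ i, constantCoeff (F i) = 1) (hQ : constantCoeff Q = 0) (μ : I → K) :
    (vecPow F μ).subst Q = vecPow (fun i => ((F i).subst Q : PowerSeries A)) μ := by
  rw [vecPow, ← PowerSeries.coe_substAlgHom (PowerSeries.HasSubst.of_constantCoeff_zero' hQ),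
    map_prod]
  refine Finset.prod_congr rfl fun j _ => ?_
  rw [PowerSeries.coe_substAlgHom, cpow_subst (hF j) hQ]

lemma vecPow_mul {F G : I → PowerSeries A} (hF : ∀ i, constantCoeff (F i) = 1)
    (hG : ∀ i, constantCoeff (G i) = 1) (μ : I → K) :
    vecPow (fun i => F i * G i) μ = vecPow F μ * vecPow G μ := by
  rw [vecPow, vecPow, vecPow, ← Finset.prod_mul_distrib]
  exact Finset.prod_congr rfl fun j _ => mul_cpow (hF j) (hG j) _

lemma vecPow_add {F : I → PowerSeries A} (hF : ∀ i, constantCoeff (F i) = 1) (μ ν : I → K) :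
    vecPow F (μ + ν) = vecPow F μ * vecPow F ν := by
  rw [vecPow, vecPow, vecPow, ← Finset.prod_mul_distrib]
  exact Finset.prod_congr rfl fun j _ => cpow_add (hF j) _ _

lemma vecPow_zero {F : I → PowerSeries A} (hF : ∀ i, constantCoeff (F i) = 1) :
    vecPow F (0 : I → K) = 1 :=
  Finset.prod_eq_one fun j _ => cpow_zero (hF j)

lemma vecPow_natCast_smul {F : I → PowerSeries A} (hF : ∀ i, constantCoeff (F i) = 1) (n : ℕ)
    (μ : I → K) : vecPow F ((n : K) • μ) = vecPow F μ ^ n := by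
  induction n with
  | zero => simpa using vecPow_zero hF
  | succ n ih => rw [Nat.cast_succ, add_smul, one_smul, vecPow_add hF, ih, pow_succ]

lemma vecPow_smul_single [DecidableEq I] {F : I → PowerSeries A}
    (hF : ∀ i, constantCoeff (F i) = 1) (i : I) (a : K) :
    vecPow F (a • (Pi.single i 1 : I → K)) = cpow (F i) a := by
  rw [vecPow, Finset.prod_eq_single i]
  · simp
  · intro j _ hj
    simpa [Pi.single_eq_of_ne hj] using cpow_zero (hF j)
  · simp

lemma vecPow_sum {ι : Type*} {F : I → PowerSeries A} (hF : ∀ i, constantCoeff (F i) = 1)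
    (t : Finset ι) (μ : ι → I → K) : vecPow F (∑ j ∈ t, μ j) = ∏ j ∈ t, vecPow F (μ j) := by
  induction t using Finset.cons_induction with
  | empty => simpa using vecPow_zero hF
  | cons j t hj ih => rw [Finset.sum_cons, Finset.prod_cons, vecPow_add hF, ih]

lemma constantCoeff_invCharge (s : I → K)
    (F : I → PowerSeries A) : constantCoeff (invCharge s F) = 0 := by
  simp [invCharge]

end BinomialPowers

/-! ### General Dyson–Schwinger systems as `X`-adic fixed-point problems -/

section Systems

section ApplySeries

variable {K M N : Type*} [Field K] [CommRing M] [Algebra K M] [CommRing N] [Algebra K N]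

lemma coeff_applySeries (Λ : M →ₗ[K] N) (F : PowerSeries M) (n : ℕ) :
    coeff n (applySeries Λ F) = Λ (coeff n F) := PowerSeries.coeff_mk _ _

lemma applySeries_X_pow_mul (Λ : M →ₗ[K] N) (w : ℕ) (F : PowerSeries M) :
    applySeries Λ (PowerSeries.X ^ w * F) = PowerSeries.X ^ w * applySeries Λ F := by
  ext n
  simp only [coeff_applySeries, PowerSeries.coeff_X_pow_mul', apply_ite Λ, map_zero]

lemma applySeries_sub (Λ : M →ₗ[K] N) (F G : PowerSeries M) :
    applySeries Λ (F - G) = applySeries Λ F - applySeries Λ G := by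
  ext n
  simp [coeff_applySeries]

lemma applySeries_congr (Λ : M →ₗ[K] N) {F G : PowerSeries M} {n : ℕ}
    (h : PowerSeries.X ^ n ∣ F - G) :
    PowerSeries.X ^ n ∣ applySeries Λ F - applySeries Λ G := by
  obtain ⟨R, hR⟩ := h
  exact ⟨applySeries Λ R, by rw [← applySeries_sub, hR, applySeries_X_pow_mul]⟩

end ApplySeries

variable {K P I A : Type*} {E : P → Type*} [Field K] [CharZero K] [Fintype I]
  [∀ p, Fintype (E p)] [CommRing A] [Algebra K A] {M : P → Type*} [∀ p, CommRing (M p)]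
  [∀ p, Algebra K (M p)]

/-- The summand `x ^ w p Λ p (∏ e, F(x) ^ μ e)` of a Dyson-Schwinger system, where the factor with
index `e` is transported along `ι p e : A → M p`. -/
noncomputable def dsTerm (w : P → ℕ) (μ : ∀ p, E p → I → K) (ι : ∀ p, E p → A →ₐ[K] M p)
    (Λ : ∀ p, M p →ₗ[K] A) (F : I → PowerSeries A) (p : P) : PowerSeries A :=
  PowerSeries.X ^ w p *
    applySeries (Λ p) (∏ e, map (ι p e).toRingHom (vecPow F (μ p e)))

/-- The right-hand side of a Dyson-Schwinger system with inhomogeneous term `c`. -/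
noncomputable def dsMap (part : P → I) (w : P → ℕ) (μ : ∀ p, E p → I → K)
    (ι : ∀ p, E p → A →ₐ[K] M p) (Λ : ∀ p, M p →ₗ[K] A) (c F : I → PowerSeries A) :
    I → PowerSeries A :=
  fun i => c i + sumSeries fun p : {p // part p = i} => dsTerm w μ ι Λ F p.1

section SumSeries

variable {w : P → ℕ} (hfin : ∀ n, {p | w p = n}.Finite)

include hfin in
lemma finite_weight_le (n : ℕ) : {p | w p ≤ n}.Finite := by
  have : {p | w p ≤ n} = ⋃ m ∈ Finset.range (n + 1), {p | w p = m} := by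
    ext p; simp
  rw [this]
  exact Set.Finite.biUnion (Finset.finite_toSet _) fun m _ => hfin m

include hfin in
lemma finite_support_coeff {Q : P → Prop} {F : {p // Q p} → PowerSeries A}
    (hF : ∀ p, PowerSeries.X ^ w p.1 ∣ F p) (n : ℕ) :
    (Function.support fun p => coeff n (F p)).Finite := by
  refine Set.Finite.subset ((finite_weight_le hfin n).preimage
    (Subtype.val_injective.injOn)) fun p hp => ?_
  by_contra h
  exact hp (PowerSeries.X_pow_dvd_iff.1 (hF p) n (not_le.1 h))

lemma coeff_sumSeries {ι' : Type*} (F : ι' → PowerSeries A) (n : ℕ) :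
    coeff n (sumSeries F) = ∑ᶠ j, coeff n (F j) := PowerSeries.coeff_mk _ _

lemma constantCoeff_sumSeries {Q : P → Prop} (hw : ∀ p, 1 ≤ w p)
    {F : {p // Q p} → PowerSeries A} (hF : ∀ p, PowerSeries.X ^ w p.1 ∣ F p) :
    constantCoeff (sumSeries F) = 0 := by
  rw [← PowerSeries.coeff_zero_eq_constantCoeff_apply, coeff_sumSeries]
  exact finsum_eq_zero_of_forall_eq_zero fun p =>
    PowerSeries.X_pow_dvd_iff.1 (hF p) 0 (hw p.1)

lemma sumSeries_congr {ι' : Type*} {F G : ι' → PowerSeries A} {n : ℕ}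
    (h : ∀ j, PowerSeries.X ^ n ∣ F j - G j) :
    PowerSeries.X ^ n ∣ sumSeries F - sumSeries G := by
  rw [PowerSeries.X_pow_dvd_iff]
  intro m hm
  rw [map_sub, coeff_sumSeries, coeff_sumSeries, sub_eq_zero]
  refine finsum_congr fun j => ?_
  rw [← sub_eq_zero, ← map_sub]
  exact PowerSeries.X_pow_dvd_iff.1 (h j) m hm

end SumSeries

variable {part : P → I} {w : P → ℕ} {μ : ∀ p, E p → I → K} {ι : ∀ p, E p → A →ₐ[K] M p}
  {Λ : ∀ p, M p →ₗ[K] A} {c : I → PowerSeries A}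

lemma X_pow_dvd_dsTerm (F : I → PowerSeries A) (p : P) :
    PowerSeries.X ^ w p ∣ dsTerm w μ ι Λ F p := dvd_mul_right _ _

/-- No condition on `F` is needed, because each summand carries the factor `X ^ w p`. Hence every
solution automatically has constant term 1, and the laws of binomial powers apply to it. -/
lemma constantCoeff_dsMap (hw : ∀ p, 1 ≤ w p) (hc : ∀ i, constantCoeff (c i) = 1)
    (F : I → PowerSeries A) (i : I) : constantCoeff (dsMap part w μ ι Λ c F i) = 1 := by
  rw [dsMap, map_add, hc, constantCoeff_sumSeries hw fun p => X_pow_dvd_dsTerm F p.1, add_zero]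

/-- The contraction property: powers, products and coefficientwise linear maps preserve congruence
modulo `X ^ n`, and the prefactor `X ^ w p` with `w p ≥ 1` gains one more order. -/
lemma dsMap_congr (hw : ∀ p, 1 ≤ w p) {F G : I → PowerSeries A}
    (hF : ∀ i, constantCoeff (F i) = 1) (hG : ∀ i, constantCoeff (G i) = 1) {n : ℕ}
    (h : ∀ i, PowerSeries.X ^ n ∣ F i - G i) (i : I) :
    PowerSeries.X ^ (n + 1) ∣ dsMap part w μ ι Λ c F i - dsMap part w μ ι Λ c G i := by
  rw [dsMap, dsMap, add_sub_add_left_eq_sub]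
  refine sumSeries_congr fun p => ?_
  rw [dsTerm, dsTerm, ← mul_sub, pow_succ']
  refine mul_dvd_mul (dvd_pow_self _ (Nat.one_le_iff_ne_zero.1 (hw p.1)))
    (applySeries_congr _ (dvd_prod_sub_prod _ _ fun e _ => ?_))
  have h2 := map_dvd (map (ι p.1 e).toRingHom) (vecPow_congr hF hG (μ p.1 e) h)
  rwa [map_pow, PowerSeries.map_X, map_sub] at h2

lemma dsMap_unique (hw : ∀ p, 1 ≤ w p) (hc : ∀ i, constantCoeff (c i) = 1)
    {F G : I → PowerSeries A} (hF : F = dsMap part w μ ι Λ c F)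
    (hG : G = dsMap part w μ ι Λ c G) : F = G := by
  have cF : ∀ i, constantCoeff (F i) = 1 := fun i => by
    rw [hF]; exact constantCoeff_dsMap hw hc F i
  have cG : ∀ i, constantCoeff (G i) = 1 := fun i => by
    rw [hG]; exact constantCoeff_dsMap hw hc G i
  have key : ∀ n i, PowerSeries.X ^ n ∣ F i - G i := by
    intro n
    induction n with
    | zero => simp
    | succ n ih =>
      intro i
      rw [hF, hG]
      exact dsMap_congr hw cF cG ih i
  funext i
  ext n
  rw [← sub_eq_zero, ← map_sub]
  exact PowerSeries.X_pow_dvd_iff.1 (key (n + 1) i) n n.lt_succ_self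

lemma exists_dsMap_fixed (hw : ∀ p, 1 ≤ w p) (hc : ∀ i, constantCoeff (c i) = 1) :
    ∃ F : I → PowerSeries A, F = dsMap part w μ ι Λ c F := by
  -- Picard iteration from `c`. By contraction the `n`-th coefficient is constant from the iterate
  -- `n + 1` on, and these stable values define the limit.
  let S : ℕ → I → PowerSeries A := fun k => (dsMap part w μ ι Λ c)^[k] c
  have hS : ∀ k, S (k + 1) = dsMap part w μ ι Λ c (S k) := fun k =>
    Function.iterate_succ_apply' _ _ _
  have cS : ∀ k i, constantCoeff (S k i) = 1 := by
    rintro (_ | k) i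
    · exact hc i
    · rw [hS]; exact constantCoeff_dsMap hw hc _ i
  have step : ∀ k i, PowerSeries.X ^ k ∣ S (k + 1) i - S k i := by
    intro k
    induction k with
    | zero => simp
    | succ k ih =>
      intro i
      rw [hS (k + 1), hS k]
      exact dsMap_congr hw (fun j => by rw [← hS]; exact cS _ j) (cS k)
        (fun j => by rw [← hS]; exact ih j) i
  have stab : ∀ n m, n < m → ∀ i, coeff n (S m i) = coeff n (S (n + 1) i) := by
    intro n m hm i
    induction m, hm using Nat.le_induction with
    | base => rfl
    | succ m hm ih =>
      rw [← ih, ← sub_eq_zero, ← map_sub]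
      exact PowerSeries.X_pow_dvd_iff.1 (step m i) n hm
  let F : I → PowerSeries A := fun i => PowerSeries.mk fun n => coeff n (S (n + 1) i)
  have hFS : ∀ n i, PowerSeries.X ^ n ∣ F i - S n i := by
    intro n i
    rw [PowerSeries.X_pow_dvd_iff]
    intro m hm
    rw [map_sub, PowerSeries.coeff_mk, stab m n hm, sub_self]
  have cF : ∀ i, constantCoeff (F i) = 1 := fun i => by
    rw [← PowerSeries.coeff_zero_eq_constantCoeff_apply, PowerSeries.coeff_mk,
      PowerSeries.coeff_zero_eq_constantCoeff_apply, cS]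
  refine ⟨F, ?_⟩
  funext i
  ext n
  -- The `n`-th coefficient of the limit is that of `S (n + 1) = dsMap (S n)`. As the limit agrees
  -- with `S n` modulo `X ^ n`, their images agree modulo `X ^ (n + 1)`.
  rw [PowerSeries.coeff_mk, hS, eq_comm, ← sub_eq_zero, ← map_sub]
  exact PowerSeries.X_pow_dvd_iff.1 (dsMap_congr hw cF (cS n) (hFS n) i) n n.lt_succ_self

end Systems

/-! ### Composition of series and its interaction with tensor products -/

section Composition

variable {A B : Type*} [CommRing A] [CommRing B]

/-- Since `X ∣ Q`, the terms with `Q ^ d` contribute to the coefficient of `x ^ m` only if `d ≤ m`.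
So all inner sums can be extended to the common range `d ≤ n` and interchanged with the convolution.
-/
lemma coeff_mul_subst {Q : PowerSeries A} (hQ : constantCoeff Q = 0) (G g : PowerSeries A)
    (n : ℕ) : coeff n (G * g.subst Q) =
      ∑ d ∈ Finset.range (n + 1), coeff d g * coeff n (G * Q ^ d) := by
  simp only [PowerSeries.coeff_mul, Finset.mul_sum]
  rw [Finset.sum_comm]
  refine Finset.sum_congr rfl fun p hp => ?_
  have hle : p.2 ≤ n := by
    have := Finset.HasAntidiagonal.mem_antidiagonal.1 hp
    omega
  rw [coeff_subst_of_constantCoeff_zero hQ, Finset.mul_sum]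
  refine (Finset.sum_subset (Finset.range_mono (by omega)) fun d _ hd => ?_).trans
    (Finset.sum_congr rfl fun d _ => mul_left_comm _ _ _)
  have hlt : p.2 < d := by simpa using hd
  obtain ⟨R, hR⟩ := PowerSeries.X_dvd_iff.2 hQ
  rw [hR, mul_pow, PowerSeries.coeff_X_pow_mul']
  simp [hlt.not_ge]

lemma constantCoeff_map_eq_zero (f : A →+* B) {F : PowerSeries A} (hF : constantCoeff F = 0) :
    constantCoeff (map f F) = 0 := by
  rw [← PowerSeries.coeff_zero_eq_constantCoeff_apply, PowerSeries.coeff_map,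
    PowerSeries.coeff_zero_eq_constantCoeff_apply, hF, map_zero]

lemma map_series_subst (f : A →+* B) {Q : PowerSeries A} (hQ : constantCoeff Q = 0)
    (g : PowerSeries A) : map f (g.subst Q : PowerSeries A) = (map f g).subst (map f Q) := by
  ext n
  rw [PowerSeries.coeff_map, coeff_subst_of_constantCoeff_zero hQ,
    coeff_subst_of_constantCoeff_zero (constantCoeff_map_eq_zero f hQ), map_sum]
  simp [← map_pow]

lemma subst_mul_of_constantCoeff_zero {Q : PowerSeries A} (hQ : constantCoeff Q = 0)
    (f g : PowerSeries A) :
    ((f * g).subst Q : PowerSeries A) = f.subst Q * g.subst Q :=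
  PowerSeries.subst_mul (PowerSeries.HasSubst.of_constantCoeff_zero' hQ) _ _

lemma subst_X_pow {Q : PowerSeries A} (hQ : constantCoeff Q = 0) (n : ℕ) :
    ((PowerSeries.X ^ n : PowerSeries A).subst Q : PowerSeries A) = Q ^ n := by
  rw [PowerSeries.subst_pow (PowerSeries.HasSubst.of_constantCoeff_zero' hQ),
    PowerSeries.subst_X (PowerSeries.HasSubst.of_constantCoeff_zero' hQ)]

lemma X_pow_dvd_subst {Q : PowerSeries A} (hQ : constantCoeff Q = 0) {n : ℕ} {g : PowerSeries A}
    (h : PowerSeries.X ^ n ∣ g) : PowerSeries.X ^ n ∣ (g.subst Q : PowerSeries A) := by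
  obtain ⟨r, rfl⟩ := h
  rw [subst_mul_of_constantCoeff_zero hQ, subst_X_pow hQ]
  exact dvd_mul_of_dvd_left (pow_dvd_pow_of_dvd (PowerSeries.X_dvd_iff.2 hQ) n) _

/-- Modulo `X ^ (n + 1)` only the finitely many indices of weight at most `n` contribute. There `Ψ`
commutes with the sum by additivity, and by hypothesis it does not lower the order of the remainder.
-/
lemma map_sumSeries {P : Type*} {w : P → ℕ} (hfin : ∀ n, {p | w p = n}.Finite) {S : P → Prop}
    {F : {p // S p} → PowerSeries A} (hF : ∀ p, PowerSeries.X ^ w p.1 ∣ F p)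
    (Ψ : PowerSeries A →+ PowerSeries B)
    (hΨ : ∀ n g, PowerSeries.X ^ n ∣ g → PowerSeries.X ^ n ∣ Ψ g) :
    Ψ (sumSeries F) = sumSeries fun p => Ψ (F p) := by
  ext n
  have hf : {p : {p // S p} | w p.1 ≤ n}.Finite :=
    (finite_weight_le hfin n).preimage Subtype.val_injective.injOn
  have hsum : ∀ {C : Type _} [CommRing C] (G : {p // S p} → PowerSeries C),
      (∀ p, PowerSeries.X ^ w p.1 ∣ G p) → ∀ m ≤ n,
      coeff m (sumSeries G) = coeff m (∑ p ∈ hf.toFinset, G p) := by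
    intro C _ G hG m hm
    rw [coeff_sumSeries, map_sum]
    refine finsum_eq_sum_of_support_subset _ fun p hp => ?_
    simp only [Set.Finite.coe_toFinset, Set.mem_ofPred_eq]
    by_contra h
    exact hp (PowerSeries.X_pow_dvd_iff.1 (hG p) m (by omega))
  have hdvd : PowerSeries.X ^ (n + 1) ∣ sumSeries F - ∑ p ∈ hf.toFinset, F p := by
    rw [PowerSeries.X_pow_dvd_iff]
    intro m hm
    rw [map_sub, hsum F hF m (by omega), sub_self]
  have h1 := PowerSeries.X_pow_dvd_iff.1 (hΨ _ _ hdvd) n n.lt_succ_self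
  have h2 : coeff n (sumSeries fun p => Ψ (F p)) = coeff n (∑ p ∈ hf.toFinset, Ψ (F p)) := by
    rw [coeff_sumSeries, map_sum]
    refine finsum_eq_sum_of_support_subset _ fun p hp => ?_
    simp only [Set.Finite.coe_toFinset, Set.mem_ofPred_eq]
    by_contra h
    exact hp (PowerSeries.X_pow_dvd_iff.1 (hΨ _ _ (hF p)) n (by omega))
  rw [map_sub, map_sub, sub_eq_zero, map_sum] at h1
  rw [h1, h2]

lemma X_pow_dvd_map (f : A →+* B) {n : ℕ} {g : PowerSeries A} (h : PowerSeries.X ^ n ∣ g) :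
    PowerSeries.X ^ n ∣ map f g := by
  simpa using map_dvd (map f) h

lemma sumSeries_add {P : Type*} {w : P → ℕ} (hfin : ∀ n, {p | w p = n}.Finite) {S : P → Prop}
    {F G : {p // S p} → PowerSeries A} (hF : ∀ p, PowerSeries.X ^ w p.1 ∣ F p)
    (hG : ∀ p, PowerSeries.X ^ w p.1 ∣ G p) :
    sumSeries (fun p => F p + G p) = sumSeries F + sumSeries G := by
  ext n
  rw [map_add, coeff_sumSeries, coeff_sumSeries, coeff_sumSeries,
    ← finsum_add_distrib (finite_support_coeff hfin hF n) (finite_support_coeff hfin hG n)]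
  simp

variable {K H M : Type*} [Field K] [CommRing H] [Algebra K H] [CommRing M] [Algebra K M]

lemma map_map_algHom {L : Type*} [CommRing L] [Algebra K L] (f : M →ₐ[K] L) (g : H →ₐ[K] M)
    (F : PowerSeries H) :
    map f.toRingHom (map g.toRingHom F) = map (f.comp g).toRingHom F :=
  Rio.map_map_series _ _ _

lemma coeff_tensor_mul_subst {Q : PowerSeries H} (hQ : constantCoeff Q = 0) (G : PowerSeries H)
    (g : PowerSeries M) (n : ℕ) :
    coeff n (map (includeLeft : H →ₐ[K] H ⊗[K] M).toRingHom G *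
      (map (includeRight : M →ₐ[K] H ⊗[K] M).toRingHom g).subst
        (map (includeLeft : H →ₐ[K] H ⊗[K] M).toRingHom Q)) =
      ∑ d ∈ Finset.range (n + 1), coeff n (G * Q ^ d) ⊗ₜ[K] coeff d g := by
  rw [coeff_mul_subst (constantCoeff_map_eq_zero _ hQ)]
  refine Finset.sum_congr rfl fun d _ => ?_
  rw [← map_pow, ← map_mul, PowerSeries.coeff_map, PowerSeries.coeff_map]
  simp

/-- By `coeff_tensor_mul_subst` the coefficients are sums of `[x ^ n](G Q ^ d) ⊗ g_d`. The
composition acts only on the left factor through `Q ^ d`, so it commutes with `Λ` acting on the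
right factor. -/
lemma applySeries_lTensor (Λ : M →ₗ[K] H) {Q : PowerSeries H} (hQ : constantCoeff Q = 0)
    (G : PowerSeries H) (g : PowerSeries M) :
    applySeries (Λ.lTensor H) (map (includeLeft : H →ₐ[K] H ⊗[K] M).toRingHom G *
      (map (includeRight : M →ₐ[K] H ⊗[K] M).toRingHom g).subst
        (map (includeLeft : H →ₐ[K] H ⊗[K] M).toRingHom Q)) =
      map (includeLeft : H →ₐ[K] H ⊗[K] H).toRingHom G *
      (map (includeRight : H →ₐ[K] H ⊗[K] H).toRingHom (applySeries Λ g)).subst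
        (map (includeLeft : H →ₐ[K] H ⊗[K] H).toRingHom Q) := by
  ext n
  rw [coeff_applySeries, coeff_tensor_mul_subst hQ, coeff_tensor_mul_subst hQ, map_sum]
  simp [coeff_applySeries]

end Composition

/-! ### The coproduct formula for solutions -/

section Coproduct

variable {K P I H : Type*} {E : P → Type*} [Field K] [CharZero K] [Fintype I] [DecidableEq I]
  [∀ p, Fintype (E p)] [CommRing H] [Bialgebra K H] {M : P → Type*} [∀ p, CommRing (M p)]
  [∀ p, Algebra K (M p)]
  {part : P → I} {w : P → ℕ} {μ : ∀ p, E p → I → K} {ι : ∀ p, E p → H →ₐ[K] M p}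
  {Λ : ∀ p, M p →ₗ[K] H} {δ : ∀ p, M p →ₐ[K] H ⊗[K] M p}

/-- The series `F(x) ⊗ 1 · (1 ⊗ F)(Q(x) ⊗ 1)`. -/
noncomputable def tensorComp (K : Type*) {H : Type*} [Field K] [CommRing H] [Algebra K H]
    (F Q : PowerSeries H) : PowerSeries (H ⊗[K] H) :=
  map (includeLeft : H →ₐ[K] H ⊗[K] H).toRingHom F *
    (map (includeRight : H →ₐ[K] H ⊗[K] H).toRingHom F).subst
      (map (includeLeft : H →ₐ[K] H ⊗[K] H).toRingHom Q)

/-- The cocycle identity splits off the summand `· ⊗ 1` and leaves `(id ⊗ Λ) δ`. By `hδ` the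
coaction on a transported factor is the coproduct on the original one, so `δ` merely replaces `F` by
`Δ F` inside the product. -/
lemma map_comul_dsTerm
    (hδ : ∀ p e, (δ p).comp (ι p e) =
      (Algebra.TensorProduct.map (.id K H) (ι p e)).comp (Bialgebra.comulAlgHom K H))
    (hΛ : ∀ p, IsOneCocycle (δ p).toLinearMap (Λ p)) {F : I → PowerSeries H}
    (cF : ∀ i, constantCoeff (F i) = 1) (p : P) :
    map (Bialgebra.comulAlgHom K H).toRingHom (dsTerm w μ ι Λ F p) =
      map (includeLeft : H →ₐ[K] H ⊗[K] H).toRingHom (dsTerm w μ ι Λ F p) +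
      dsTerm w μ (fun p e => Algebra.TensorProduct.map (.id K H) (ι p e))
        (fun p => (Λ p).lTensor H)
        (fun i => map (Bialgebra.comulAlgHom K H).toRingHom (F i)) p := by
  set g := ∏ e, map (ι p e).toRingHom (vecPow F (μ p e)) with hg
  have h1 : map (δ p).toRingHom g = ∏ e,
      map (Algebra.TensorProduct.map (.id K H) (ι p e)).toRingHom
        (vecPow (fun i => map (Bialgebra.comulAlgHom K H).toRingHom (F i)) (μ p e)) := by
    rw [hg, map_prod]
    refine Finset.prod_congr rfl fun e _ => ?_
    rw [← map_vecPow _ cF, Rio.map_map_series, Rio.map_map_series]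
    exact congrArg (fun f : H →ₐ[K] H ⊗[K] M p => map f.toRingHom (vecPow F (μ p e))) (hδ p e)
  have h2 : map (Bialgebra.comulAlgHom K H).toRingHom (applySeries (Λ p) g) =
      map (includeLeft : H →ₐ[K] H ⊗[K] H).toRingHom (applySeries (Λ p) g) +
      applySeries ((Λ p).lTensor H) (map (δ p).toRingHom g) := by
    ext n
    rw [map_add, PowerSeries.coeff_map, PowerSeries.coeff_map, coeff_applySeries,
      coeff_applySeries, PowerSeries.coeff_map]
    exact hΛ p _
  rw [dsTerm, dsTerm, map_mul, map_mul, map_pow, map_pow, PowerSeries.map_X, PowerSeries.map_X,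
    ← hg, h2, h1, mul_add]

/-- Binomial powers respect products and substitution, so each factor splits into a left part and a
right part composed with `Q ⊗ 1`. The left parts multiply to `F_i (Q / x) ^ w p`, `i = part p`; the
prefactor `x ^ w p` completes this to `F_i Q ^ w p`, and `Q ^ w p` is what `x ^ w p` becomes under
the substitution. -/
lemma dsTerm_tensorComp {s : I → K}
    (hμ : ∀ p, ∑ e, μ p e = Pi.single (part p) 1 + (w p : K) • s) {F : I → PowerSeries H}
    (cF : ∀ i, constantCoeff (F i) = 1) (p : P) :
    dsTerm w μ (fun p e => Algebra.TensorProduct.map (.id K H) (ι p e))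
        (fun p => (Λ p).lTensor H) (fun i => tensorComp K (F i) (invCharge s F)) p =
      map (includeLeft : H →ₐ[K] H ⊗[K] H).toRingHom (F (part p)) *
        (map (includeRight : H →ₐ[K] H ⊗[K] H).toRingHom (dsTerm w μ ι Λ F p)).subst
          (map (includeLeft : H →ₐ[K] H ⊗[K] H).toRingHom (invCharge s F)) := by
  set Q := invCharge s F with hQdef
  have hQ : constantCoeff Q = 0 := constantCoeff_invCharge s F
  have hfac : ∀ e, map (Algebra.TensorProduct.map (.id K H) (ι p e)).toRingHom
      (vecPow (fun i => tensorComp K (F i) Q) (μ p e)) =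
      map (includeLeft : H →ₐ[K] H ⊗[K] M p).toRingHom (vecPow F (μ p e)) *
      (map (includeRight : M p →ₐ[K] H ⊗[K] M p).toRingHom
        (map (ι p e).toRingHom (vecPow F (μ p e)))).subst
        (map (includeLeft : H →ₐ[K] H ⊗[K] M p).toRingHom Q) := by
    intro e
    have hL : (Algebra.TensorProduct.map (.id K H) (ι p e)).comp
        (includeLeft : H →ₐ[K] H ⊗[K] H) = includeLeft := by ext x; simp
    have hR : (Algebra.TensorProduct.map (.id K H) (ι p e)).comp
        (includeRight : H →ₐ[K] H ⊗[K] H) = includeRight.comp (ι p e) := by ext x; simp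
    have hQ' := constantCoeff_map_eq_zero
      (includeLeft : H →ₐ[K] H ⊗[K] H).toRingHom hQ
    simp only [tensorComp]
    rw [vecPow_mul (fun i => constantCoeff_map_eq_one _ (cF i))
      (fun i => by
        rw [constantCoeff_subst_of_constantCoeff_zero hQ']
        exact constantCoeff_map_eq_one _ (cF i)),
      ← vecPow_subst (fun i => constantCoeff_map_eq_one _ (cF i)) hQ',
      ← map_vecPow _ cF, ← map_vecPow _ cF, map_mul, map_series_subst _ hQ',
      map_map_algHom, map_map_algHom, map_map_algHom, hL, hR, ← map_map_algHom]
  -- The only use of the shape of the exponents: their sum is the `part p`-th unit vector plus `w p`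
  -- times `s`.
  have hprod : ∏ e, vecPow F (μ p e) = F (part p) * vecPow F s ^ w p := by
    rw [← vecPow_sum cF, hμ, vecPow_add cF, vecPow_natCast_smul cF]
    congr 1
    simpa [cpow_one (cF _)] using vecPow_smul_single (K := K) cF (part p) 1
  have hQM := constantCoeff_map_eq_zero (includeLeft : H →ₐ[K] H ⊗[K] M p).toRingHom hQ
  rw [dsTerm, dsTerm, Finset.prod_congr rfl fun e _ => hfac e, Finset.prod_mul_distrib,
    ← map_prod, hprod, ← applySeries_X_pow_mul, ← applySeries_X_pow_mul,
    ← applySeries_lTensor _ hQ]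
  congr 1
  -- What remains is an identity between the arguments of `id ⊗ Λ`, namely `x ^ w (F^s) ^ w = Q ^ w`
  -- on the left tensor factors.
  rw [map_mul (map (includeRight : M p →ₐ[K] H ⊗[K] M p).toRingHom),
    subst_mul_of_constantCoeff_zero hQM, map_pow, PowerSeries.map_X, subst_X_pow hQM,
    map_prod (map (includeRight : M p →ₐ[K] H ⊗[K] M p).toRingHom)]
  have hsub : ∀ f : E p → PowerSeries (H ⊗[K] M p), ((∏ e, f e).subst
      (map (includeLeft : H →ₐ[K] H ⊗[K] M p).toRingHom Q) : PowerSeries (H ⊗[K] M p)) =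
      ∏ e, (f e).subst (map (includeLeft : H →ₐ[K] H ⊗[K] M p).toRingHom Q) := by
    intro f
    simp only [← PowerSeries.coe_substAlgHom (PowerSeries.HasSubst.of_constantCoeff_zero' hQM),
      map_prod]
  rw [hsub, hQdef, invCharge, map_mul, map_mul, map_pow, PowerSeries.map_X, mul_pow]
  ring

theorem map_comul_eq_tensorComp (hw : ∀ p, 1 ≤ w p) (hfin : ∀ n, {p | w p = n}.Finite)
    {s : I → K} (hμ : ∀ p, ∑ e, μ p e = Pi.single (part p) 1 + (w p : K) • s)
    (hδ : ∀ p e, (δ p).comp (ι p e) =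
      (Algebra.TensorProduct.map (.id K H) (ι p e)).comp (Bialgebra.comulAlgHom K H))
    (hΛ : ∀ p, IsOneCocycle (δ p).toLinearMap (Λ p)) {F : I → PowerSeries H}
    (hF : F = dsMap part w μ ι Λ 1 F) (i : I) :
    map (Bialgebra.comulAlgHom K H).toRingHom (F i) = tensorComp K (F i) (invCharge s F) := by
  have cF : ∀ i, constantCoeff (F i) = 1 := fun i => by
    rw [hF]; exact constantCoeff_dsMap hw (by simp) F i
  have hQ := constantCoeff_map_eq_zero (includeLeft : H →ₐ[K] H ⊗[K] H).toRingHom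
    (constantCoeff_invCharge s F)
  have hcomul := map_comul_dsTerm (w := w) (μ := μ) hδ hΛ cF
  have hcomp := dsTerm_tensorComp (Λ := Λ) (ι := ι) hμ cF
  have hFi : ∀ i, F i = 1 + sumSeries fun p : {p // part p = i} => dsTerm w μ ι Λ F p.1 :=
    fun i => congrFun hF i
  have mapSum : ∀ (f : H →ₐ[K] H ⊗[K] H) (i : I),
      map f.toRingHom (F i) = 1 + sumSeries fun p : {p // part p = i} =>
        map f.toRingHom (dsTerm w μ ι Λ F p.1) := by
    intro f i
    conv_lhs => rw [hFi i]
    rw [map_add, map_one]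
    congr 1
    exact map_sumSeries hfin (fun p => X_pow_dvd_dsTerm F p.1)
      (map f.toRingHom).toAddMonoidHom fun n g h => X_pow_dvd_map _ h
  -- Uniqueness over `H ⊗ H`. The inhomogeneous term is `F i ⊗ 1` rather than 1: on the coproduct
  -- side it collects the parts `· ⊗ 1` of all the summands.
  refine congrFun (f := fun i => map (Bialgebra.comulAlgHom K H).toRingHom (F i))
    (g := fun i => tensorComp K (F i) (invCharge s F)) (dsMap_unique (part := part) (w := w)
      (μ := μ) (ι := fun p e => Algebra.TensorProduct.map (.id K H) (ι p e))
      (Λ := fun p => (Λ p).lTensor H)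
      (c := fun i => map (includeLeft : H →ₐ[K] H ⊗[K] H).toRingHom (F i)) hw
      (fun i => constantCoeff_map_eq_one _ (cF i)) ?_ ?_) i
  · funext i
    rw [mapSum, dsMap, mapSum, add_assoc, ← sumSeries_add hfin
      (fun p => X_pow_dvd_map _ (X_pow_dvd_dsTerm F p.1)) (fun p => X_pow_dvd_dsTerm _ p.1)]
    simp only [hcomul]
  · funext i
    -- `g ↦ (F_i ⊗ 1) · (1 ⊗ g)(Q ⊗ 1)`, which is additive and does not lower the order. Applied to
    -- `F_i = 1 + ∑ …`, it sends the term 1 to the inhomogeneous term `F_i ⊗ 1`.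
    let Ψ : PowerSeries H →+ PowerSeries (H ⊗[K] H) :=
      (AddMonoidHom.mulLeft (map (includeLeft : H →ₐ[K] H ⊗[K] H).toRingHom (F i))).comp
        ((PowerSeries.substAlgHom (R := H ⊗[K] H)
          (PowerSeries.HasSubst.of_constantCoeff_zero' hQ)).toRingHom.toAddMonoidHom.comp
          (map (includeRight : H →ₐ[K] H ⊗[K] H).toRingHom).toAddMonoidHom)
    have hΨ : ∀ g, Ψ g = map (includeLeft : H →ₐ[K] H ⊗[K] H).toRingHom (F i) *
        (map (includeRight : H →ₐ[K] H ⊗[K] H).toRingHom g).subst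
          (map (includeLeft : H →ₐ[K] H ⊗[K] H).toRingHom (invCharge s F)) := fun g => by
      rw [← PowerSeries.coe_substAlgHom (PowerSeries.HasSubst.of_constantCoeff_zero' hQ)]
      rfl
    have hsum := map_sumSeries hfin (S := fun p => part p = i)
      (fun p => X_pow_dvd_dsTerm (w := w) (μ := μ) (ι := ι) (Λ := Λ) F p.1) Ψ fun n g h => by
        rw [hΨ]
        exact dvd_mul_of_dvd_right (X_pow_dvd_subst hQ (X_pow_dvd_map _ h)) _
    rw [tensorComp, ← hΨ, dsMap]
    conv_lhs => rw [hFi i]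
    rw [map_add, hsum]
    congr 1
    · rw [hΨ, map_one, subst_one_eq hQ, mul_one]
    · congr 1
      funext p
      rw [hcomp, hΨ, p.2]

end Coproduct

/-! ### From the coproduct formula to morphisms from the Riordan bialgebra -/

section RiordanMorphism

variable {K P I H : Type*} {E : P → Type*} [Field K] [CharZero K] [Fintype I]
  [∀ p, Fintype (E p)] [CommRing H] [Bialgebra K H] {M : P → Type*} [∀ p, CommRing (M p)]
  [∀ p, Algebra K (M p)]
  {part : P → I} {w : P → ℕ} {μ : ∀ p, E p → I → K} {ι : ∀ p, E p → H →ₐ[K] M p}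
  {Λ : ∀ p, M p →ₗ[K] H} {s : I → K} {F : I → PowerSeries H}

lemma map_invCharge {A B : Type*} [CommRing A] [Algebra K A] [CommRing B] [Algebra K B]
    (f : A →ₐ[K] B) {F : I → PowerSeries A} (cF : ∀ i, constantCoeff (F i) = 1) (s : I → K) :
    map f.toRingHom (invCharge s F) = invCharge s fun i => map f.toRingHom (F i) := by
  rw [invCharge, invCharge, map_mul, PowerSeries.map_X, map_vecPow f cF]

/-- Raising the formulas for the `F_j` to the powers `s_j` and multiplying gives `(F^s ⊗ 1) · (1 ⊗
F^s)(Q ⊗ 1)`. The remaining factor `x` turns `F^s ⊗ 1` into `Q ⊗ 1`, which is the image of `x` under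
the substitution. -/
lemma map_comul_invCharge (cF : ∀ i, constantCoeff (F i) = 1)
    (hF : ∀ i, map (Bialgebra.comulAlgHom K H).toRingHom (F i) =
      tensorComp K (F i) (invCharge s F)) :
    map (Bialgebra.comulAlgHom K H).toRingHom (invCharge s F) =
      (map (includeRight : H →ₐ[K] H ⊗[K] H).toRingHom (invCharge s F)).subst
        (map (includeLeft : H →ₐ[K] H ⊗[K] H).toRingHom (invCharge s F)) := by
  have hQ := constantCoeff_map_eq_zero (includeLeft : H →ₐ[K] H ⊗[K] H).toRingHom
    (constantCoeff_invCharge s F)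
  have hX := subst_X_pow hQ 1
  rw [pow_one, pow_one] at hX
  rw [map_invCharge _ cF]
  simp only [hF, tensorComp]
  rw [invCharge, vecPow_mul (fun i => constantCoeff_map_eq_one _ (cF i))
    (fun i => by
      rw [constantCoeff_subst_of_constantCoeff_zero hQ]
      exact constantCoeff_map_eq_one _ (cF i)),
    ← vecPow_subst (fun i => constantCoeff_map_eq_one _ (cF i)) hQ,
    ← map_vecPow _ cF, ← map_vecPow _ cF, ← mul_assoc]
  have hR : map (includeRight : H →ₐ[K] H ⊗[K] H).toRingHom (invCharge s F) =
      PowerSeries.X * map (includeRight : H →ₐ[K] H ⊗[K] H).toRingHom (vecPow F s) := by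
    rw [invCharge, map_mul, PowerSeries.map_X]
  conv_rhs => rw [hR, subst_mul_of_constantCoeff_zero hQ, hX]
  congr 1
  rw [invCharge, map_mul, PowerSeries.map_X]

/-- The counit kills the image of every `Λ p`, so only the constant 1 survives. -/
lemma map_counit_eq_one (hfin : ∀ n, {p | w p = n}.Finite)
    (hε : ∀ p m, Coalgebra.counit (R := K) (Λ p m) = 0) (hF : F = dsMap part w μ ι Λ 1 F)
    (i : I) : map (Bialgebra.counitAlgHom K H).toRingHom (F i) = 1 := by
  have h0 : ∀ p, map (Bialgebra.counitAlgHom K H).toRingHom (dsTerm w μ ι Λ F p) = 0 := by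
    intro p
    rw [dsTerm, map_mul]
    refine mul_eq_zero_of_right _ ?_
    ext n
    rw [PowerSeries.coeff_map, coeff_applySeries]
    exact hε p _
  rw [hF, dsMap, map_add, Pi.one_apply, map_one]
  refine add_eq_left.2 ((map_sumSeries hfin (S := fun p => part p = i)
    (fun p => X_pow_dvd_dsTerm F p.1)
    (map (Bialgebra.counitAlgHom K H).toRingHom).toAddMonoidHom
    fun n g h => X_pow_dvd_map (Bialgebra.counitAlgHom K H).toRingHom h).trans ?_)
  ext n
  rw [coeff_sumSeries]
  exact finsum_eq_zero_of_forall_eq_zero fun p =>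
    congrArg (coeff n) (h0 p.1)

lemma map_counit_invCharge (cF : ∀ i, constantCoeff (F i) = 1)
    (hF : ∀ i, map (Bialgebra.counitAlgHom K H).toRingHom (F i) = 1) :
    map (Bialgebra.counitAlgHom K H).toRingHom (invCharge s F) = PowerSeries.X := by
  rw [map_invCharge _ cF]
  simp only [hF, invCharge, vecPow, one_cpow, Finset.prod_const_one, mul_one]

/-- The two lowest coefficients of `Π` are the constants 0 and 1, not generators, so `Q` has to
match them. -/
lemma Rio.map_lift_Pi {A : Type*} [CommRing A] [Algebra K A] {Q : PowerSeries A} (b : ℕ → A)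
    (h0 : coeff 0 Q = 0) (h1 : coeff 1 Q = 1) :
    map (Rio.lift K (fun n => coeff (n + 1) Q) b).toRingHom (Rio.Pi K) = Q := by
  ext n
  rcases n with _ | _ | n
  · rw [h0]; simp [Rio.Pi]
  · rw [h1, Rio.Pi, PowerSeries.coeff_map, PowerSeries.coeff_succ_X_mul, PowerSeries.coeff_mk]
    exact map_one _
  · rw [Rio.Pi, PowerSeries.coeff_map, PowerSeries.coeff_succ_X_mul, PowerSeries.coeff_mk]
    exact Rio.lift_π _ _ _

lemma Rio.map_lift_Y {A : Type*} [CommRing A] [Algebra K A] {T : PowerSeries A} (a : ℕ → A)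
    (h0 : coeff 0 T = 1) : map (Rio.lift K a fun n => coeff n T).toRingHom (Rio.Y K) = T := by
  ext n
  rcases n with _ | n
  · rw [h0, Rio.Y, PowerSeries.coeff_map, PowerSeries.coeff_mk]
    exact map_one _
  · rw [Rio.Y, PowerSeries.coeff_map, PowerSeries.coeff_mk]
    exact Rio.lift_y _ _ _

/-- Algebra morphisms out of `Rio K` are determined by the images of `Π` and `Y` (`Rio.hom_ext`), so
compatibility with coproduct and counit need only be checked on these two series, where it is the
hypotheses. -/
theorem exists_rio_bialgHom {T Q : PowerSeries H} (hT : coeff 0 T = 1) (hQ0 : coeff 0 Q = 0)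
    (hQ1 : coeff 1 Q = 1)
    (hΔT : map (Bialgebra.comulAlgHom K H).toRingHom T = tensorComp K T Q)
    (hΔQ : map (Bialgebra.comulAlgHom K H).toRingHom Q =
      (map (includeRight : H →ₐ[K] H ⊗[K] H).toRingHom Q).subst
        (map (includeLeft : H →ₐ[K] H ⊗[K] H).toRingHom Q))
    (hεT : map (Bialgebra.counitAlgHom K H).toRingHom T = 1)
    (hεQ : map (Bialgebra.counitAlgHom K H).toRingHom Q = PowerSeries.X) :
    ∃ φ : Rio K →ₐc[K] H, map (φ : Rio K →+* H) (Rio.Y K) = T ∧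
      map (φ : Rio K →+* H) (Rio.Pi K) = Q := by
  let φ₀ : Rio K →ₐ[K] H := Rio.lift K (fun n => coeff (n + 1) Q) fun n => coeff n T
  have hPi : map φ₀.toRingHom (Rio.Pi K) = Q := Rio.map_lift_Pi _ hQ0 hQ1
  have hY : map φ₀.toRingHom (Rio.Y K) = T := Rio.map_lift_Y _ hT
  have hL : (Algebra.TensorProduct.map φ₀ φ₀).comp
      (includeLeft : Rio K →ₐ[K] Rio K ⊗[K] Rio K) = includeLeft.comp φ₀ := by ext x; simp
  have hR : (Algebra.TensorProduct.map φ₀ φ₀).comp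
      (includeRight : Rio K →ₐ[K] Rio K ⊗[K] Rio K) = includeRight.comp φ₀ := by ext x; simp
  have hcounit : (Bialgebra.counitAlgHom K H).comp φ₀ = Bialgebra.counitAlgHom K (Rio K) := by
    refine Rio.hom_ext ?_ ?_
    · rw [← map_map_algHom, hPi, hεQ]
      exact (Rio.map_counit_Pi (AlgHom.id K K)).symm
    · rw [← map_map_algHom, hY, hεT]
      exact (Rio.map_counit_Y (AlgHom.id K K)).symm
  have hcomul : (Algebra.TensorProduct.map φ₀ φ₀).comp (Bialgebra.comulAlgHom K (Rio K)) =
      (Bialgebra.comulAlgHom K H).comp φ₀ := by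
    refine Rio.hom_ext ?_ ?_
    · refine (Rio.map_hom_comul_Pi (Algebra.TensorProduct.map φ₀ φ₀)).trans ?_
      rw [hL, hR, ← map_map_algHom, ← map_map_algHom, ← map_map_algHom, hPi, hΔQ]
    · refine (Rio.map_hom_comul_Y (Algebra.TensorProduct.map φ₀ φ₀)).trans ?_
      rw [hL, hR, ← map_map_algHom, ← map_map_algHom, ← map_map_algHom, ← map_map_algHom, hPi,
        hY, hΔT, tensorComp]
  exact ⟨BialgHom.ofAlgHom φ₀ hcounit hcomul, hY, hPi⟩

end RiordanMorphism

/-! ### The combinatorial system on decorated trees -/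

section Trees

variable {K P I : Type*} {E : P → Type*} [Field K] [CharZero K] [Fintype I]
  [∀ p, Fintype (E p)] [∀ p, DecidableEq (E p)]

/-- Brings the tree system into the general form, with marked forests in place of the tensor power.
The multilinear map underlying `CK.Bplus` is multiplicative, so it induces an algebra morphism that
restricts to `CK.colour` on each tensor factor. -/
lemma applySeries_Bplus (p : P) (F : E p → PowerSeries (CK K P E)) :
    applySeries (CK.Bplus K p) (tensorSeries K F) =
      applySeries (CK.graft K p) (∏ e, map (CK.colour K p e).toRingHom (F e)) := by
  let m := (MultilinearMap.mkPiAlgebra K (E p)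
    (MvPolynomial (E p × DTree P E) K)).compLinearMap fun e => (CK.colour K p e).toLinearMap
  let f : (⨂[K] _ : E p, CK K P E) →ₐ[K] MvPolynomial (E p × DTree P E) K :=
    PiTensorProduct.liftAlgHom m (by simp [m]) fun x y => by simp [m, Finset.prod_mul_distrib]
  have hf : ∀ e, f.comp (PiTensorProduct.singleAlgHom e) = CK.colour K p e := by
    intro e
    refine AlgHom.ext fun x => ?_
    have h1 : f (PiTensorProduct.singleAlgHom e x) =
        ∏ e', CK.colour K p e' (Pi.mulSingle (M := fun _ => CK K P E) e x e') :=
      PiTensorProduct.lift.tprod _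
    rw [AlgHom.comp_apply, h1, Finset.prod_eq_single e]
    · simp
    · intro e' _ he
      rw [Pi.mulSingle_eq_of_ne he, map_one]
    · simp
  have h2 : map f.toRingHom (tensorSeries K F) =
      ∏ e, map (CK.colour K p e).toRingHom (F e) := by
    rw [tensorSeries, map_prod]
    exact Finset.prod_congr rfl fun e _ => by rw [map_map_algHom, hf]
  rw [← h2]
  ext n
  rw [coeff_applySeries, coeff_applySeries, PowerSeries.coeff_map]
  rfl

lemma tensorSeries_X_pow_mul {A ε : Type*} [CommRing A] [Algebra K A] [Fintype ε]
    [DecidableEq ε] (α : ε → ℕ) (F : ε → PowerSeries A) :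
    tensorSeries K (fun e => PowerSeries.X ^ α e * F e) =
      PowerSeries.X ^ (∑ e, α e) * tensorSeries K F := by
  simp only [tensorSeries, map_mul, map_pow, PowerSeries.map_X, Finset.prod_mul_distrib,
    Finset.prod_pow_eq_pow_sum]

variable {part : P → I} {w : P → ℕ} {μ : ∀ p, E p → I → K} {u : ∀ p, E p → K}
  {α : ∀ p, E p → ℕ} {s : I → K} {T : I → PowerSeries (CK K P E)}

lemma isCombSolution_iff : IsCombSolution part w μ T ↔
    T = dsMap part w μ (fun p e => CK.colour K p e) (fun p => CK.graft K p) 1 T := by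
  rw [funext_iff]
  refine forall_congr' fun i => ?_
  simp only [dsMap, dsTerm, ← applySeries_Bplus]
  rfl

lemma applySeries_Bplus_invCharge (hα : ∀ p, ∑ e, α p e = w p) (i : I) (p : P) :
    applySeries (CK.Bplus K p)
      (tensorSeries K fun e => cpow (T i) (u p e) * invCharge s T ^ α p e) =
    PowerSeries.X ^ w p * applySeries (CK.Bplus K p)
      (tensorSeries K fun e => cpow (T i) (u p e) * vecPow T s ^ α p e) := by
  rw [← hα, ← applySeries_X_pow_mul, ← tensorSeries_X_pow_mul]
  congr 2
  funext e
  rw [invCharge, mul_pow]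
  ring

/-- The explicit factor `x` in `Q` already supplies `X ^ w p`, without any power law for `T`. -/
lemma IsCombSolutionQ.constantCoeff_eq_one (hw : ∀ p, 1 ≤ w p)
    (hα : ∀ p, ∑ e, α p e = w p) (h : IsCombSolutionQ part u α s T) (i : I) :
    constantCoeff (T i) = 1 := by
  rw [h i, map_add, map_one, constantCoeff_sumSeries hw, add_zero]
  intro p
  rw [applySeries_Bplus_invCharge hα]
  exact dvd_mul_right _ _

/-- The two right-hand sides agree by the laws of exponents, which require constant terms 1; either
system forces these. -/
lemma isCombSolutionQ_iff [DecidableEq I] (hw : ∀ p, 1 ≤ w p) (hα : ∀ p, ∑ e, α p e = w p)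
    (hμ : ∀ p e, μ p e = u p e • Pi.single (part p) 1 + (α p e : K) • s) :
    IsCombSolutionQ part u α s T ↔ IsCombSolution part w μ T := by
  have key : (∀ i, constantCoeff (T i) = 1) →
      (IsCombSolutionQ part u α s T ↔ IsCombSolution part w μ T) := by
    intro cT
    refine forall_congr' fun i => ?_
    have hterm : ∀ p : {p // part p = i}, applySeries (CK.Bplus K p.1)
        (tensorSeries K fun e => cpow (T i) (u p.1 e) * invCharge s T ^ α p.1 e) =
        PowerSeries.X ^ w p.1 * applySeries (CK.Bplus K p.1)
          (tensorSeries K fun e => vecPow T (μ p.1 e)) := by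
      rintro ⟨p, rfl⟩
      rw [applySeries_Bplus_invCharge hα]
      simp only [hμ, vecPow_add cT, vecPow_natCast_smul cT, vecPow_smul_single cT]
    simp only [hterm]
  constructor
  · intro h
    exact (key (h.constantCoeff_eq_one hw hα)).1 h
  · intro h
    refine (key fun i => ?_).2 h
    rw [isCombSolution_iff.1 h]
    exact constantCoeff_dsMap hw (by simp) T i

theorem exists_combSolution [DecidableEq I] (hw : ∀ p, 1 ≤ w p)
    (hfin : ∀ n, {p | w p = n}.Finite) (hα : ∀ p, ∑ e, α p e = w p)
    (hμ : ∀ p e, μ p e = u p e • Pi.single (part p) 1 + (α p e : K) • s)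
    (hμ' : ∀ p, ∑ e, μ p e = Pi.single (part p) 1 + (w p : K) • s) :
    ∃ T : I → PowerSeries (CK K P E),
      IsCombSolutionQ part u α s T ∧
      (∀ T' : I → PowerSeries (CK K P E), IsCombSolutionQ part u α s T' → T' = T) ∧
      IsCombSolution part w μ T ∧
      ∀ i, ∃ φ : Rio K →ₐc[K] CK K P E,
        map (φ : Rio K →+* CK K P E) (Rio.Y K) = T i ∧
        map (φ : Rio K →+* CK K P E) (Rio.Pi K) = invCharge s T := by
  obtain ⟨T, hT⟩ := exists_dsMap_fixed (part := part) (w := w) (μ := μ)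
    (ι := fun p e => CK.colour K p e) (Λ := fun p => CK.graft K p)
    (c := (1 : I → PowerSeries (CK K P E))) hw (by simp)
  have hsol : IsCombSolution part w μ T := isCombSolution_iff.2 hT
  have cT : ∀ i, constantCoeff (T i) = 1 := fun i => by
    rw [hT]; exact constantCoeff_dsMap hw (by simp) T i
  refine ⟨T, (isCombSolutionQ_iff hw hα hμ).2 hsol, fun T' hT' => ?_, hsol, fun i => ?_⟩
  · exact dsMap_unique hw (by simp)
      (isCombSolution_iff.1 ((isCombSolutionQ_iff hw hα hμ).1 hT')) hT
  · have hΔ := map_comul_eq_tensorComp (δ := fun p => CK.coact K p) hw hfin hμ'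
      (fun p e => CK.coact_colour K p e) (fun p m => CK.comulHom_graft K p m) hT
    have hε := map_counit_eq_one hfin (fun p m => CK.counit_graft K p m) hT
    refine exists_rio_bialgHom ?_ ?_ ?_ (hΔ i) (map_comul_invCharge cT hΔ) (hε i)
      (map_counit_invCharge cT hε)
    · rw [PowerSeries.coeff_zero_eq_constantCoeff_apply, cT]
    · rw [PowerSeries.coeff_zero_eq_constantCoeff_apply, constantCoeff_invCharge]
    · rw [invCharge, ← zero_add 1, PowerSeries.coeff_succ_X_mul,
        PowerSeries.coeff_zero_eq_constantCoeff_apply, constantCoeff_vecPow cT]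

end Trees

/-! ### The renormalization group equation -/

section RenormalizationGroup

variable {K : Type*} [Field K]

lemma comul_X : Coalgebra.comul (R := K) (Polynomial.X : Polynomial K) =
    1 ⊗ₜ[K] Polynomial.X + Polynomial.X ⊗ₜ[K] 1 :=
  Polynomial.aeval_X _

lemma counit_poly (f : Polynomial K) : Coalgebra.counit (R := K) f = f.coeff 0 :=
  (Polynomial.coeff_zero_eq_aeval_zero f).symm

lemma polyCoaction_comp_aeval {ε : Type*} (e : ε) :
    (polyCoaction K ε).comp (Polynomial.aeval (MvPolynomial.X e)) =
      (Algebra.TensorProduct.map (.id K (Polynomial K))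
        (Polynomial.aeval (MvPolynomial.X (R := K) e))).comp
        (Bialgebra.comulAlgHom K (Polynomial K)) := by
  refine Polynomial.algHom_ext ?_
  simp [polyCoaction, comul_X, add_comm]

lemma rTensor_counit_polyCoaction {ε : Type*} (m : MvPolynomial ε K) :
    (Coalgebra.counit (R := K) (A := Polynomial K)).rTensor (MvPolynomial ε K)
      (polyCoaction K ε m) = 1 ⊗ₜ m := by
  have h : (Algebra.TensorProduct.map (Bialgebra.counitAlgHom K (Polynomial K))
      (.id K (MvPolynomial ε K))).comp (polyCoaction K ε) =
      Algebra.TensorProduct.includeRight := by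
    refine MvPolynomial.algHom_ext fun e => ?_
    simp [polyCoaction, counit_poly]
  exact DFunLike.congr_fun h m

/-- A 1-cocycle on a counital comodule is annihilated by the counit. -/
lemma IsOneCocycle.counit_eq_zero {H M : Type*} [CommRing H] [Bialgebra K H] [AddCommGroup M]
    [Module K M] {δ : M →ₗ[K] H ⊗[K] M} {Λ : M →ₗ[K] H} (hΛ : IsOneCocycle δ Λ)
    (hδ : ∀ m, (Coalgebra.counit (R := K) (A := H)).rTensor M (δ m) = 1 ⊗ₜ m) (m : M) :
    Coalgebra.counit (R := K) (Λ m) = 0 := by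
  -- Applying `ε ⊗ id` to the cocycle identity gives `1 ⊗ Λ m = ε(Λ m) ⊗ 1 + 1 ⊗ Λ m`.
  have h1 := congrArg ((Coalgebra.counit (R := K) (A := H)).rTensor H) (hΛ m)
  have h2 : (Coalgebra.counit (R := K) (A := H)).rTensor H (Λ.lTensor H (δ m)) =
      Λ.lTensor K ((Coalgebra.counit (R := K) (A := H)).rTensor M (δ m)) := by
    generalize δ m = x
    induction x with
    | zero => simp
    | add x y hx hy => simp only [map_add, hx, hy]
    | tmul a b => simp
  rw [Coalgebra.rTensor_counit_comul, map_add, h2, hδ, LinearMap.rTensor_tmul,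
    LinearMap.lTensor_tmul, right_eq_add] at h1
  have h3 := congrArg (fun x => Coalgebra.counit (R := K) (TensorProduct.lid K H x)) h1
  simpa using h3

/-- The linear map `a ⊗ b ↦ a'(0) b`. -/
noncomputable def linLeft (K : Type*) [Field K] :
    Polynomial K ⊗[K] Polynomial K →ₗ[K] Polynomial K :=
  TensorProduct.lid K (Polynomial K) ∘ₗ (Polynomial.lcoeff K 1).rTensor (Polynomial K)

lemma linLeft_tmul (a b : Polynomial K) : linLeft K (a ⊗ₜ b) = a.coeff 1 • b := by
  simp [linLeft]

/-- A Leibniz rule: `a ↦ a'(0)` is a derivation over evaluation at 0. It drives the induction on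
powers of `L` in `linLeft_comul`. -/
lemma linLeft_mul_comul_X (z : Polynomial K ⊗[K] Polynomial K) :
    linLeft K (z * (1 ⊗ₜ[K] Polynomial.X + Polynomial.X ⊗ₜ[K] 1)) =
      linLeft K z * Polynomial.X + TensorProduct.lid K (Polynomial K)
        ((Coalgebra.counit (R := K) (A := Polynomial K)).rTensor (Polynomial K) z) := by
  induction z with
  | zero => simp
  | add x y hx hy => rw [add_mul, map_add, hx, hy]; simp only [map_add, add_mul]; abel
  | tmul a b =>
    rw [mul_add, map_add, Algebra.TensorProduct.tmul_mul_tmul,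
      Algebra.TensorProduct.tmul_mul_tmul, linLeft_tmul, linLeft_tmul, linLeft_tmul]
    simp [counit_poly]

/-- The coproduct is `f(L₁ + L₂)`, and its derivative in `L₁` at `L₁ = 0` is `f'(L₂)`. -/
lemma linLeft_comul (f : Polynomial K) :
    linLeft K (Coalgebra.comul (R := K) f) = Polynomial.derivative f := by
  suffices h : linLeft K ∘ₗ Coalgebra.comul (R := K) = Polynomial.derivative (R := K) from
    DFunLike.congr_fun h f
  refine (Polynomial.basisMonomials K).ext fun n => ?_
  rw [Polynomial.coe_basisMonomials, LinearMap.comp_apply]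
  simp only [← Polynomial.X_pow_eq_monomial]
  induction n with
  | zero => simp [linLeft_tmul, Algebra.TensorProduct.one_def, Polynomial.coeff_one]
  | succ n ih =>
    rw [pow_succ, Bialgebra.comul_mul, comul_X, linLeft_mul_comul_X, ih,
      Coalgebra.rTensor_counit_comul]
    simp

lemma coeff_linL (F : PowerSeries (Polynomial K)) (n : ℕ) :
    coeff n (linL F) = (coeff n F).coeff 1 := PowerSeries.coeff_mk _ _

lemma coeff_map_counit (F : PowerSeries (Polynomial K)) (n : ℕ) :
    coeff n (map (Bialgebra.counitAlgHom K (Polynomial K)).toRingHom F) =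
      (coeff n F).coeff 0 := by
  rw [PowerSeries.coeff_map]
  exact counit_poly _

lemma linL_mul (F G : PowerSeries (Polynomial K)) :
    linL (F * G) =
      linL F * map (Bialgebra.counitAlgHom K (Polynomial K)).toRingHom G +
      map (Bialgebra.counitAlgHom K (Polynomial K)).toRingHom F * linL G := by
  ext n
  simp only [coeff_linL, map_add, PowerSeries.coeff_mul, coeff_map_counit,
    Polynomial.finsetSum_coeff, Polynomial.mul_coeff_one, ← Finset.sum_add_distrib]
  exact Finset.sum_congr rfl fun p _ => add_comm _ _

lemma linL_one : linL (1 : PowerSeries (Polynomial K)) = 0 := by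
  ext n
  rw [coeff_linL, PowerSeries.coeff_one]
  split_ifs <;> simp [Polynomial.coeff_one]

lemma linL_X : linL (PowerSeries.X : PowerSeries (Polynomial K)) = 0 := by
  ext n
  rw [coeff_linL, PowerSeries.coeff_X]
  split_ifs <;> simp [Polynomial.coeff_one]

lemma linL_sub (F G : PowerSeries (Polynomial K)) : linL (F - G) = linL F - linL G := by
  ext n
  simp [coeff_linL]

lemma linL_prod {ι : Type*} (t : Finset ι) {F : ι → PowerSeries (Polynomial K)}
    (hF : ∀ j, map (Bialgebra.counitAlgHom K (Polynomial K)).toRingHom (F j) = 1) :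
    linL (∏ j ∈ t, F j) = ∑ j ∈ t, linL (F j) := by
  induction t using Finset.cons_induction with
  | empty => simpa using linL_one
  | cons j t hj ih =>
    rw [Finset.prod_cons, Finset.sum_cons, linL_mul, ih, hF, map_prod,
      Finset.prod_congr rfl fun j _ => hF j]
    simp

lemma linL_pow {Q : PowerSeries (Polynomial K)}
    (hQ : map (Bialgebra.counitAlgHom K (Polynomial K)).toRingHom Q = PowerSeries.X) (d : ℕ) :
    linL (Q ^ (d + 1)) = (d + 1 : ℕ) • (PowerSeries.X ^ d * linL Q) := by
  induction d with
  | zero => simp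
  | succ d ih =>
    rw [pow_succ, linL_mul, ih, hQ, map_pow, hQ]
    simp only [nsmul_eq_mul]
    push_cast
    ring

variable [CharZero K]

/-- `F - 1` vanishes at `L = 0`, so its powers from the second on have no term linear in `L`. Only
`a (F - 1)` is left of the binomial series. -/
lemma linL_cpow {F : PowerSeries (Polynomial K)} (cF : constantCoeff F = 1)
    (hF : map (Bialgebra.counitAlgHom K (Polynomial K)).toRingHom F = 1) (a : K) :
    linL (cpow F a) = a • linL F := by
  have h0 : ∀ k, linL ((F - 1) ^ (k + 2)) = 0 := by
    intro k
    rw [pow_succ, linL_mul, map_pow, map_sub, hF, map_one, sub_self]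
    simp
  ext n
  rw [coeff_linL, coeff_cpow cF, Polynomial.finsetSum_coeff]
  simp only [Polynomial.coeff_smul, ← coeff_linL]
  rcases n with _ | n
  · simp [coeff_linL, PowerSeries.coeff_zero_eq_constantCoeff_apply, cF,
      Polynomial.coeff_one]
  · rw [Finset.sum_range_succ', Finset.sum_range_succ']
    simp [h0, linL_one, linL_sub]

variable {I : Type*} [Fintype I]

/-- Identifies the beta function as the coefficient of `L` in the invariant charge, by the
logarithmic behaviour of `linL` on series equal to 1 at `L = 0`. -/
lemma linL_invCharge {G : I → PowerSeries (Polynomial K)}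
    (cG : ∀ i, constantCoeff (G i) = 1)
    (hG : ∀ i, map (Bialgebra.counitAlgHom K (Polynomial K)).toRingHom (G i) = 1) (s : I → K) :
    linL (invCharge s G) = PowerSeries.X * ∑ j, s j • linL (G j) := by
  rw [invCharge, linL_mul, linL_X, zero_mul, zero_add, PowerSeries.map_X, vecPow, linL_prod]
  · simp only [linL_cpow (cG _) (hG _)]
  · intro j
    rw [map_cpow _ (cG j), hG, one_cpow]

/-- Applying `linLeft` to the coproduct formula gives `∂F/∂L` on one side and `∑ d, linL (F Q ^ d)
F_d` on the other, where `F_d` is the coefficient of `x ^ d`. As `F = 1` and `Q = x` at `L = 0`, the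
Leibniz rule gives `linL (F Q ^ d) = γ x ^ d + d x ^ (d - 1) β`, and summation yields `γ F + β
∂F/∂x`. -/
theorem satisfiesRGE_of_map_comul {F Q : PowerSeries (Polynomial K)}
    (hΔ : map (Bialgebra.comulAlgHom K (Polynomial K)).toRingHom F = tensorComp K F Q)
    (hQ0 : constantCoeff Q = 0)
    (hF : map (Bialgebra.counitAlgHom K (Polynomial K)).toRingHom F = 1)
    (hQ : map (Bialgebra.counitAlgHom K (Polynomial K)).toRingHom Q = PowerSeries.X) :
    SatisfiesRGE (linL Q) (linL F) F := by
  have hβ : coeff 0 (linL Q) = 0 := by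
    rw [coeff_linL,
      PowerSeries.coeff_zero_eq_constantCoeff_apply, hQ0, Polynomial.coeff_zero]
  -- Composition with `Q = X` writes an ordinary product as a sum over the coefficients of `g`, in
  -- the same shape as the expanded coproduct.
  have expand : ∀ (a : PowerSeries K) (g : PowerSeries (Polynomial K)) (n : ℕ),
      coeff n (map Polynomial.C a * g) = ∑ d ∈ Finset.range (n + 1),
        coeff n (a * PowerSeries.X ^ d) • coeff d g := by
    intro a g n
    have h := coeff_mul_subst (A := Polynomial K) (Q := PowerSeries.X) (by simp)
      (map Polynomial.C a) g n
    rw [PowerSeries.X_subst] at h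
    rw [h]
    refine Finset.sum_congr rfl fun d _ => ?_
    rw [← PowerSeries.map_X Polynomial.C, ← map_pow, ← map_mul, PowerSeries.coeff_map,
      Polynomial.smul_eq_C_mul, mul_comm]
  have hlin : ∀ d, linL (F * Q ^ d) = linL F * PowerSeries.X ^ d + linL (Q ^ d) := by
    intro d
    rw [linL_mul, map_pow, hF, hQ, one_mul]
  rw [SatisfiesRGE, sub_sub, sub_eq_zero]
  ext1 n
  have h1 : Polynomial.derivative (coeff n F) =
      ∑ d ∈ Finset.range (n + 1), coeff n (linL (F * Q ^ d)) • coeff d F := by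
    have h := congrArg (linLeft K) (congrArg (coeff n) hΔ)
    rw [tensorComp, coeff_tensor_mul_subst hQ0, map_sum, PowerSeries.coeff_map] at h
    refine (linLeft_comul _).symm.trans (h.trans ?_)
    simp only [linLeft_tmul, coeff_linL]
  -- The index shifts by one under `∂/∂x`. The two unmatched boundary terms vanish: `d = 0` on the
  -- left because `linL 1 = 0`, and `d = n` on the right because `β` has no constant term.
  have h2 : ∑ d ∈ Finset.range (n + 1), coeff n (linL (Q ^ d)) • coeff d F =
      coeff n (map Polynomial.C (linL Q) * PowerSeries.derivative (Polynomial K) F) := by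
    rw [expand, Finset.sum_range_succ', Finset.sum_range_succ]
    congr 1
    · refine Finset.sum_congr rfl fun d _ => ?_
      rw [linL_pow hQ, PowerSeries.coeff_derivative, mul_comm (linL Q), map_nsmul, smul_assoc,
        smul_comm, nsmul_eq_mul]
      congr 1
      push_cast
      ring
    · rw [pow_zero, linL_one, PowerSeries.coeff_mul_X_pow', if_pos le_rfl, Nat.sub_self,
        hβ, map_zero, zero_smul, zero_smul]
  rw [coeff_applySeries, h1, map_add, ← h2, expand, ← Finset.sum_add_distrib]
  refine Finset.sum_congr rfl fun d _ => ?_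
  rw [hlin, map_add, add_smul, add_comm]

variable {P : Type*} {E : P → Type*} [DecidableEq I] [∀ p, Fintype (E p)]
  {part : P → I} {w : P → ℕ} {μ : ∀ p, E p → I → K} {s : I → K}
  {Λ : ∀ p, MvPolynomial (E p) K →ₗ[K] Polynomial K}

lemma isDSESolution_iff {G : I → PowerSeries (Polynomial K)} : IsDSESolution part w μ Λ G ↔
    G = dsMap part w μ (fun _ e => Polynomial.aeval (R := K) (MvPolynomial.X (R := K) e))
      Λ 1 G :=
  funext_iff.symm

theorem exists_dseSolution (hw : ∀ p, 1 ≤ w p) (hfin : ∀ n, {p | w p = n}.Finite)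
    (hμ : ∀ p, ∑ e, μ p e = Pi.single (part p) 1 + (w p : K) • s)
    (hΛ : ∀ p, IsOneCocycle (polyCoaction K (E p)).toLinearMap (Λ p)) :
    ∃ G : I → PowerSeries (Polynomial K),
      IsDSESolution part w μ Λ G ∧
      (∀ G' : I → PowerSeries (Polynomial K), IsDSESolution part w μ Λ G' → G' = G) ∧
      ∀ i, SatisfiesRGE (PowerSeries.X * ∑ j, s j • linL (G j)) (linL (G i)) (G i) := by
  obtain ⟨G, hG⟩ := exists_dsMap_fixed (part := part) (w := w) (μ := μ)
    (ι := fun p e => Polynomial.aeval (R := K) (MvPolynomial.X (R := K) (σ := E p) e)) (Λ := Λ)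
    (c := (1 : I → PowerSeries (Polynomial K))) hw (by simp)
  have cG : ∀ i, constantCoeff (G i) = 1 := fun i => by
    rw [hG]; exact constantCoeff_dsMap hw (by simp) G i
  refine ⟨G, isDSESolution_iff.2 hG, fun G' hG' =>
    dsMap_unique hw (by simp) (isDSESolution_iff.1 hG') hG, fun i => ?_⟩
  have hΔ := map_comul_eq_tensorComp (δ := fun p => polyCoaction K (E p)) hw hfin hμ
    (fun _ e => polyCoaction_comp_aeval e) hΛ hG
  have hε := map_counit_eq_one hfin
    (fun p => (hΛ p).counit_eq_zero rTensor_counit_polyCoaction) hG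
  rw [← linL_invCharge cG hε]
  exact satisfiesRGE_of_map_comul (hΔ i) (constantCoeff_invCharge s G) (hε i)
    (map_counit_invCharge cG hε)

end RenormalizationGroup

end DysonSchwinger

theorem mainTheorem3 {K P I : Type*} {E : P → Type*} [Field K] [CharZero K] [Fintype I]
    [DecidableEq I] [∀ p, Fintype (E p)] [∀ p, DecidableEq (E p)]
    (part : P → I) (w : P → ℕ) (hw : ∀ p, 1 ≤ w p) (hfin : ∀ n, {p | w p = n}.Finite)
    (s : I → K) (u : ∀ p, E p → K) (α : ∀ p, E p → ℕ) (μ : ∀ p, E p → I → K)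
    (hu : ∀ p, ∑ e, u p e = 1) (hα : ∀ p, ∑ e, α p e = w p)
    (hμ : ∀ p e, μ p e = u p e • Pi.single (part p) 1 + (α p e : K) • s) :
    (∃ T : I → PowerSeries (CK K P E),
      IsCombSolutionQ part u α s T ∧
      (∀ T' : I → PowerSeries (CK K P E), IsCombSolutionQ part u α s T' → T' = T) ∧
      IsCombSolution part w μ T ∧
      ∀ i, ∃ φ : Rio K →ₐc[K] CK K P E,
        PowerSeries.map (φ : Rio K →+* CK K P E) (Rio.Y K) = T i ∧
        PowerSeries.map (φ : Rio K →+* CK K P E) (Rio.Pi K) = invCharge s T) ∧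
    ∀ Λ : ∀ p, MvPolynomial (E p) K →ₗ[K] Polynomial K,
      (∀ p, IsOneCocycle (polyCoaction K (E p)).toLinearMap (Λ p)) →
      ∃ G : I → PowerSeries (Polynomial K),
        IsDSESolution part w μ Λ G ∧
        (∀ G' : I → PowerSeries (Polynomial K), IsDSESolution part w μ Λ G' → G' = G) ∧
        ∀ i, SatisfiesRGE (PowerSeries.X * ∑ j, s j • linL (G j)) (linL (G i)) (G i) := by
  -- The coproduct formula needs only this sum; the individual form of `μ p e` serves to rewrite the
  -- tree system in terms of `Q`.
  have hμ' : ∀ p, ∑ e, μ p e = Pi.single (part p) 1 + (w p : K) • s := by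
    intro p
    simp only [hμ, Finset.sum_add_distrib, ← Finset.sum_smul, hu, one_smul, ← hα, Nat.cast_sum]
  exact ⟨exists_combSolution hw hfin hα hμ hμ', fun Λ hΛ => exists_dseSolution hw hfin hμ' hΛ⟩
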